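/- **Setting.** Fix $\Lambda\ge 0$. A *frame* is a finitely supported function $p:[0,\infty)^2\to[0,\infty)$; $[\![x,y]\!]$ is the frame with value $1$ at $(x,y)$ and $0$ elsewhere, and $\mathsf{PointCount}(p)=|\{(x,y):p(x,y)\ne 0\}|$. For a positive semidefinite matrix $Z$ and a vector $\psi$ let $\mathrm{Prob}[Z,\psi](z)=\langle\psi|\Pi^{[z]}|\psi\rangle$, with $\Pi^{[z]}$ the projector onto the $z$-eigenspace of $Z$ ($0$ if $z$ is not an eigenvalue). For $g,h:[0,\infty)\to[0,\infty)$ the line transition $g\to h$ is *EBM* if there are matrices $0\le G\le H$ and a (not necessarily normalised) vector $\psi$ with $g=\mathrm{Prob}[G,\psi]$ and $h=\mathrm{Prob}[H,\psi]$. A transition $p\to q$ of frames is *EBM horizontal* (resp. *vertical*) if $p(\cdot,y)\to q(\cdot,y)$ is EBM for every $y$ (resp. $p(x,\cdot)\to q(x,\cdot)$ for every $x$). A *$\Lambda$-penalty EBM point game* with final point $[\![\beta,\alpha]\!]$, $\alpha,\beta\in[\Lambda,\Lambda+1]$, is a sequence of frames $(p_0,\dots,p_n)$ with $p_0=\tfrac12[\![\Lambda,\Lambda+1]\!]+\tfrac12[\![\Lambda+1,\Lambda]\!]$,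 $p_n=[\![\beta,\alpha]\!]$, and $p_i\to p_{i+1}$ EBM vertical for even $i$ and EBM horizontal for odd $i$. A *$\Lambda$-penWCF protocol* with $N$ messages ($N$ even) has finite-dimensional registers $\mathcal A$ (Alice), $\mathcal M$ (message), $\mathcal B$ (Bob), a unit product initial state $\psi_{A,0}\otimes\psi_{M,0}\otimes\psi_{B,0}$ with Alice holding $\mathcal M$, and rounds $i=1,\dots,N$, Alice acting on $\mathcal A\otimes\mathcal M$ for odd $i$ and Bob on $\mathcal M\otimes\mathcal B$ for even $i$: the acting player measures $\{E_i,\mathbb I-E_i\}$ ($E_i$ a projector), outputs $\bot$ and stops on the second result, and otherwise applies a unitary $U_i$ and sends $\mathcal M$ to the other player. At the end Alice and Bob make projective measurements $\{\Pi_A^{(0)},\Pi_A^{(1)},\Pi_A^{(\bot)}\}$ on $\mathcal A$ and $\{\Pi_B^{(0)},\Pi_B^{(1)},\Pi_B^{(\bot)}\}$ on $\mathcal B$. If both are honest, no measurement ever yields $\bot$, the two outputs agree, and each of the outputs $0$ and $1$ has probability $\tfrac12$. $R_A^*$ is the supremum, over all strategies of a malicious Alice (finite-dimensional private memory, arbitrary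 initial state of memory and message, arbitrary quantum channels in her rounds) against honest Bob, of the expectation of her points: $\Lambda+1$, $\Lambda$, $0$ if Bob outputs $0$, $1$, $\bot$ respectively. $R_B^*$ is defined likewise for a malicious Bob (with his own private memory in an arbitrary initial state, arbitrary channels in his rounds) against honest Alice, with $\Lambda+1$, $\Lambda$, $0$ points if Alice outputs $1$, $0$, $\bot$ respectively. **Theorem.** Let $(p_0,\dots,p_n)$ be a $\Lambda$-penalty EBM point game with final point $[\![\beta,\alpha]\!]$, and put $$D=\max_{0\le j<n}\bigl(\mathsf{PointCount}(p_j)+\mathsf{PointCount}(p_{j+1})\bigr)+1 .$$ Then there is a $\Lambda$-penWCF protocol with $R_A^*\le\alpha$ and $R_B^*\le\beta$ that uses $2n$ rounds of communication ($2n$ messages) and three registers $\mathcal A,\mathcal M,\mathcal B$ of dimension $D$ each, i.e. $3\log_2 D$ qubits. Also, there is such a protocol with $2n$ rounds in which each of the three registers consists of exactly $\lceil\log_2 D\rceil$ qubits, so that it uses $3\lceil\log_2 D\rceil$ qubits in total. -/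

import Mathlib

open Matrix
open scoped NNReal Kronecker ComplexOrder

noncomputable section

namespace PenWCF

/-! ### Expressible-by-matrices point games -/

/-- `Prob[Z, ψ](z) = ⟨ψ| Π^{[z]} |ψ⟩`, where `Π^{[z]}` is the orthogonal projector onto the
eigenspace of the Hermitian matrix `Z` for the value `z`. When `z` is not an eigenvalue, the
eigenspace is trivial and the value is `0`. -/
def Prob {d : ℕ} (Z : Matrix (Fin d) (Fin d) ℂ) (ψ : EuclideanSpace ℂ (Fin d)) (z : ℝ≥0) : ℝ :=
  (inner ℂ ψ
    ((Module.End.eigenspace (Matrix.toEuclideanLin Z) ((z : ℝ) : ℂ)).starProjection ψ)).re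

/-- The line transition `g → h` is expressible by matrices: there are `0 ≤ G ≤ H` and a (not
necessarily normalised) vector `ψ` with `g = Prob[G, ψ]` and `h = Prob[H, ψ]`. -/
def EBMLine (g h : ℝ≥0 → ℝ≥0) : Prop :=
  ∃ (d : ℕ) (G H : Matrix (Fin d) (Fin d) ℂ) (ψ : EuclideanSpace ℂ (Fin d)),
    G.PosSemidef ∧ (H - G).PosSemidef ∧
    (∀ z, (g z : ℝ) = Prob G ψ z) ∧ (∀ z, (h z : ℝ) = Prob H ψ z)

/-- A frame: a finitely supported function `[0,∞) × [0,∞) → [0,∞)`. -/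
abbrev Frame := ℝ≥0 × ℝ≥0 →₀ ℝ≥0

/-- `⟦x, y⟧` with weight `w`. -/
def weightedPoint (w x y : ℝ≥0) : Frame := Finsupp.single (x, y) w

/-- EBM horizontal transition: EBM on every line `y = const`. -/
def EBMHorizontal (p q : Frame) : Prop :=
  ∀ y : ℝ≥0, EBMLine (fun x => p (x, y)) (fun x => q (x, y))

/-- EBM vertical transition: EBM on every line `x = const`. -/
def EBMVertical (p q : Frame) : Prop :=
  ∀ x : ℝ≥0, EBMLine (fun y => p (x, y)) (fun y => q (x, y))

/-- A `Λ`-penalty EBM point game `(p₀, …, pₙ)` with final point `⟦β, α⟧`. -/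
structure EBMPointGame (Λ : ℝ≥0) (n : ℕ) (β α : ℝ≥0) where
  frame : Fin (n + 1) → Frame
  start : frame 0 = weightedPoint (1 / 2) Λ (Λ + 1) + weightedPoint (1 / 2) (Λ + 1) Λ
  vertical : ∀ i : Fin n, Even (i : ℕ) → EBMVertical (frame i.castSucc) (frame i.succ)
  horizontal : ∀ i : Fin n, Odd (i : ℕ) → EBMHorizontal (frame i.castSucc) (frame i.succ)
  final : frame (Fin.last n) = weightedPoint 1 β α
  final_x : β ∈ Set.Icc Λ (Λ + 1)
  final_y : α ∈ Set.Icc Λ (Λ + 1)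

/-- The number of points with non-zero weight. -/
def pointCount (p : Frame) : ℕ := p.support.card

/-- `max_j (PointCount(p_j) + PointCount(p_{j+1})) + 1`, the maximum over `0 ≤ j < n`. -/
def EBMPointGame.registerDim {Λ : ℝ≥0} {n : ℕ} {β α : ℝ≥0} (G : EBMPointGame Λ n β α) : ℕ :=
  (Finset.univ.sup fun j : Fin n =>
    pointCount (G.frame j.castSucc) + pointCount (G.frame j.succ)) + 1

/-! ### Operators on three registers

A register with computational basis `A` is the Hilbert space `ℂ^A`; the joint space of the
registers `A`, `M`, `B` is `ℂ^(A × M × B)`. -/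

section Lifts

variable {A M B : Type} [Fintype A] [DecidableEq A] [Fintype M] [DecidableEq M]
  [Fintype B] [DecidableEq B]

/-- `X_{AM} ⊗ 𝕀_B`. -/
def onAM (X : Matrix (A × M) (A × M) ℂ) : Matrix (A × M × B) (A × M × B) ℂ :=
  Matrix.reindex (Equiv.prodAssoc A M B) (Equiv.prodAssoc A M B) (X ⊗ₖ (1 : Matrix B B ℂ))

/-- `𝕀_A ⊗ X_{MB}`. -/
def onMB (X : Matrix (M × B) (M × B) ℂ) : Matrix (A × M × B) (A × M × B) ℂ :=
  (1 : Matrix A A ℂ) ⊗ₖ X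

/-- `X_A ⊗ 𝕀_M ⊗ Y_B`. -/
def onAB (X : Matrix A A ℂ) (Y : Matrix B B ℂ) : Matrix (A × M × B) (A × M × B) ℂ :=
  X ⊗ₖ ((1 : Matrix M M ℂ) ⊗ₖ Y)

end Lifts

/-- `|ψ⟩⟨ψ|`. -/
def ketbra {X : Type} (ψ : X → ℂ) : Matrix X X ℂ := Matrix.vecMulVec ψ (star ψ)

/-- `‖ψ‖²`. -/
def normSq {X : Type} [Fintype X] (ψ : X → ℂ) : ℝ := ∑ x, ‖ψ x‖ ^ 2

/-- A density matrix. -/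
def IsDensity {X : Type} [Fintype X] (ρ : Matrix X X ℂ) : Prop :=
  ρ.PosSemidef ∧ ρ.trace = 1

/-- A quantum channel (completely positive trace-preserving map) on `ℂ^X`, in Kraus form. -/
structure Channel (X : Type) [Fintype X] [DecidableEq X] where
  size : ℕ
  kraus : Fin size → Matrix X X ℂ
  trace_preserving : ∑ k, (kraus k)ᴴ * kraus k = 1

/-! ### Protocols -/

/-- Outcomes of a player: `zero` ("Alice wins"), `one` ("Bob wins"), `bot` ("cheating detected"). -/
inductive Outcome : Type
  | zero
  | one
  | bot

/-- A three-outcome projective measurement. -/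
structure FinalMeasurement (X : Type) [Fintype X] [DecidableEq X] where
  proj : Outcome → Matrix X X ℂ
  isProj : ∀ o, IsStarProjection (proj o)
  complete : proj .zero + proj .one + proj .bot = 1

/-- The data of a coin-flipping protocol with private registers `A`, `B` and message register `M`.

Rounds are numbered `0, …, rounds - 1`; each round ends with the sending of the message register,
so that `rounds` is the number of messages. In round `i` the acting player (Alice if `i` is even,
Bob if `i` is odd) measures the private register and the incoming message with `{E i, 1 - E i}`,
aborts with outcome `⊥` on the second result, and otherwise applies the unitary `U i` and sends
the message register to the other player. The values of `UA`, `EA` at odd `i`, of `UB`, `EB` at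
even `i`, and of all four at `i ≥ rounds`, are never used. -/
structure Protocol (A M B : Type) [Fintype A] [DecidableEq A] [Fintype M] [DecidableEq M]
    [Fintype B] [DecidableEq B] where
  rounds : ℕ
  even_rounds : Even rounds
  initA : A → ℂ
  initM : M → ℂ
  initB : B → ℂ
  initA_norm : normSq initA = 1
  initM_norm : normSq initM = 1
  initB_norm : normSq initB = 1
  UA : ℕ → Matrix (A × M) (A × M) ℂ
  EA : ℕ → Matrix (A × M) (A × M) ℂ
  UB : ℕ → Matrix (M × B) (M × B) ℂ
  EB : ℕ → Matrix (M × B) (M × B) ℂ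
  UA_unitary : ∀ i, UA i ∈ Matrix.unitaryGroup (A × M) ℂ
  UB_unitary : ∀ i, UB i ∈ Matrix.unitaryGroup (M × B) ℂ
  EA_proj : ∀ i, IsStarProjection (EA i)
  EB_proj : ∀ i, IsStarProjection (EB i)
  measA : FinalMeasurement A
  measB : FinalMeasurement B

/-- A strategy of a malicious Bob: a private memory of arbitrary finite dimension, its initial
state, and an arbitrary quantum channel on message and memory for each of his rounds. -/
structure CheatingBob (M : Type) [Fintype M] [DecidableEq M] where
  dim : ℕ
  init : Matrix (Fin dim) (Fin dim) ℂ
  init_density : IsDensity init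
  move : ℕ → Channel (M × Fin dim)

/-- A strategy of a malicious Alice: a private memory of arbitrary finite dimension, the joint
initial state of memory and message (Alice holds the message register at the beginning), and an
arbitrary quantum channel on memory and message for each of her rounds. -/
structure CheatingAlice (M : Type) [Fintype M] [DecidableEq M] where
  dim : ℕ
  init : Matrix (Fin dim × M) (Fin dim × M) ℂ
  init_density : IsDensity init
  move : ℕ → Channel (Fin dim × M)

namespace Protocol

variable {A M B : Type} [Fintype A] [DecidableEq A] [Fintype M] [DecidableEq M]
  [Fintype B] [DecidableEq B]

/-- The honest state before round `i`; the final one is `honestState P P.rounds`. -/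
def honestState (P : Protocol A M B) : ℕ → (A × M × B → ℂ)
  | 0 => fun s => P.initA s.1 * P.initM s.2.1 * P.initB s.2.2
  | i + 1 => (if Even i then onAM (P.UA i) else onMB (P.UB i)) *ᵥ honestState P i

/-- The requirements on the honest run of a penalty weak coin-flipping protocol. -/
structure IsPenWCF (P : Protocol A M B) : Prop where
  /-- The intermediate measurements of honest players never detect cheating. -/
  pass : ∀ i < P.rounds,
    (if Even i then onAM (P.EA i) else onMB (P.EB i)) *ᵥ P.honestState i = P.honestState i
  /-- At the end neither player outputs `⊥` and the outputs agree. -/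
  correct : ∀ a b : Outcome, ¬ (a = .zero ∧ b = .zero) → ¬ (a = .one ∧ b = .one) →
    onAB (P.measA.proj a) (P.measB.proj b) *ᵥ P.honestState P.rounds = 0
  /-- Alice wins with probability `1/2`. -/
  balancedA :
    normSq (onAB (P.measA.proj .zero) (P.measB.proj .zero) *ᵥ P.honestState P.rounds) = 1 / 2
  /-- Bob wins with probability `1/2`. -/
  balancedB :
    normSq (onAB (P.measA.proj .one) (P.measB.proj .one) *ᵥ P.honestState P.rounds) = 1 / 2

/-- The state of Alice's register, the message and a malicious Bob's memory before round `i`, in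
a run against honest Alice. Its trace is the probability that Alice has not aborted. -/
def stateVsBob (P : Protocol A M B) (S : CheatingBob M) :
    ℕ → Matrix (A × M × Fin S.dim) (A × M × Fin S.dim) ℂ
  | 0 => ketbra P.initA ⊗ₖ (ketbra P.initM ⊗ₖ S.init)
  | i + 1 =>
    if Even i then
      onAM (P.UA i * P.EA i) * stateVsBob P S i * (onAM (P.UA i * P.EA i))ᴴ
    else
      ∑ k, onMB ((S.move i).kraus k) * stateVsBob P S i * (onMB ((S.move i).kraus k))ᴴ

/-- The state of a malicious Alice's memory, the message and Bob's register before round `i`, in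
a run against honest Bob. Its trace is the probability that Bob has not aborted. -/
def stateVsAlice (P : Protocol A M B) (S : CheatingAlice M) :
    ℕ → Matrix (Fin S.dim × M × B) (Fin S.dim × M × B) ℂ
  | 0 => Matrix.reindex (Equiv.prodAssoc (Fin S.dim) M B) (Equiv.prodAssoc (Fin S.dim) M B)
      (S.init ⊗ₖ ketbra P.initB)
  | i + 1 =>
    if Even i then
      ∑ k, onAM ((S.move i).kraus k) * stateVsAlice P S i * (onAM ((S.move i).kraus k))ᴴ
    else
      onMB (P.UB i * P.EB i) * stateVsAlice P S i * (onMB (P.UB i * P.EB i))ᴴ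

/-- The expected number of points of a malicious Bob: `Λ + 1` if Alice outputs `1`, `Λ` if she
outputs `0`, and `0` if she outputs `⊥` (in the course of the protocol or at its end). -/
def rewardOfBob (P : Protocol A M B) (Λ : ℝ≥0) (S : CheatingBob M) : ℝ :=
  ((Λ : ℝ) + 1) * (onAB (P.measA.proj .one) 1 * P.stateVsBob S P.rounds).trace.re +
    (Λ : ℝ) * (onAB (P.measA.proj .zero) 1 * P.stateVsBob S P.rounds).trace.re

/-- The expected number of points of a malicious Alice: `Λ + 1` if Bob outputs `0`, `Λ` if he
outputs `1`, and `0` if he outputs `⊥` (in the course of the protocol or at its end). -/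
def rewardOfAlice (P : Protocol A M B) (Λ : ℝ≥0) (S : CheatingAlice M) : ℝ :=
  ((Λ : ℝ) + 1) * (onAB 1 (P.measB.proj .zero) * P.stateVsAlice S P.rounds).trace.re +
    (Λ : ℝ) * (onAB 1 (P.measB.proj .one) * P.stateVsAlice S P.rounds).trace.re

/-- The cheating reward `R_A^*`: the supremum over all strategies of a malicious Alice. -/
def cheatRewardA (P : Protocol A M B) (Λ : ℝ≥0) : EReal :=
  ⨆ S : CheatingAlice M, ((P.rewardOfAlice Λ S : ℝ) : EReal)

/-- The cheating reward `R_B^*`: the supremum over all strategies of a malicious Bob. -/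
def cheatRewardB (P : Protocol A M B) (Λ : ℝ≥0) : EReal :=
  ⨆ S : CheatingBob M, ((P.rewardOfBob Λ S : ℝ) : EReal)

end Protocol

/-- The computational basis of `q` qubits. -/
abbrev Qubits (q : ℕ) : Type := Fin q → Fin 2

end PenWCF

end

/-! The protocol plays the point game backwards. The honest state of a frame is the sum over its
points $(x,y)$ of $\sqrt{\text{weight}}\,|x\rangle_A|(x,y)\rangle_M|y\rangle_B$. The run starts in
the product state of $[\![\beta,\alpha]\!]$ and ends in the state of the first frame of the game,
whose two points are the two outcomes. Against a malicious Bob the dual certificate is the diagonal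
matrix of $x$-coordinates on Alice's register; against a malicious Alice it is that of
$y$-coordinates on Bob's. At the end it is the matrix of rewards, and on the initial state it has
expectation $\beta$ or $\alpha$. Weak duality (`Protocol.rewardOfBob_le`,
`Protocol.rewardOfAlice_le`) therefore gives the bounds, provided that no honest move increases the
certificate. The moves come from EBM. On one line $g\to h$ with $G\le H$ and $\psi$, let $g_t$,
$h_s$ be the normalised eigencomponents of $\psi$ and $K_{ts}=\langle g_t|h_s\rangle$. Then $K$ is a
contraction, it maps $\sqrt h$ to $\sqrt g$, and $K^*\mathrm{diag}(x_t)K\le\mathrm{diag}(x_s)$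
because $\langle u,Gu\rangle\le\langle u,Hu\rangle$ (`EBMLine.exists_overlap`).
`Transition.exists_unitary` completes $K$ to an isometry by a block $R$ with $R^*R=1-K^*K$, whose
output goes to basis vectors of dual value $0$, so the inequality survives. The honest state has no
component there, since $K$ preserves its norm on every line. The isometry extends to a unitary in an
arbitrary way, because the preceding projective check removes everything outside the codes of the
current frame. A horizontal move keeps the set of occupied $y$, so Bob's code and certificate do not
change in it; vertical moves are symmetric. Each step of the game takes two rounds, in one of which
the frame is unchanged, hence $2n$ rounds. A register needs one basis vector per point of a single
frame and one vector `bot`, which $D$ provides. -/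

noncomputable section

namespace PenWCF

set_option linter.unusedSectionVars false

/-! ### Spectral components of a vector under positive operators -/

section Spectral

variable {E : Type*} [NormedAddCommGroup E] [InnerProductSpace ℂ E] [FiniteDimensional ℂ E]

/-- The orthogonal projection onto the eigenspace of `T` for the value `z`. -/
def specProj (T : E →ₗ[ℂ] E) (z : ℝ≥0) : E →L[ℂ] E :=
  (Module.End.eigenspace T ((z : ℝ) : ℂ)).starProjection

/-- The normalised component of `ψ` in the eigenspace of `T` for the value `z`. -/
def specVec (T : E →ₗ[ℂ] E) (ψ : E) (z : ℝ≥0) : E :=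
  ((‖specProj T z ψ‖⁻¹ : ℝ) : ℂ) • specProj T z ψ

theorem apply_specProj (T : E →ₗ[ℂ] E) (z : ℝ≥0) (u : E) :
    T (specProj T z u) = ((z : ℝ) : ℂ) • specProj T z u :=
  Module.End.mem_eigenspace_iff.1 (Submodule.starProjection_apply_mem _ u)

theorem specProj_of_eigen {T : E →ₗ[ℂ] E} (hT : T.IsSymmetric) {w : ℝ≥0} {b : E}
    (hb : T b = ((w : ℝ) : ℂ) • b) (z : ℝ≥0) : specProj T z b = if z = w then b else 0 := by
  have hmem : b ∈ Module.End.eigenspace T ((w : ℝ) : ℂ) := Module.End.mem_eigenspace_iff.2 hb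
  split_ifs with h
  · subst h
    exact Submodule.starProjection_eq_self_iff.2 hmem
  · refine (Submodule.starProjection_apply_eq_zero_iff _).2 fun v hv => ?_
    have hne : ((z : ℝ) : ℂ) ≠ ((w : ℝ) : ℂ) := fun h' => h (by exact_mod_cast h')
    exact hT.orthogonalFamily_eigenspaces hne ⟨v, hv⟩ ⟨b, hmem⟩

theorem inner_specProj_left (T : E →ₗ[ℂ] E) (z : ℝ≥0) (u v : E) :
    inner ℂ (specProj T z u) v = inner ℂ u (specProj T z v) :=
  Submodule.inner_starProjection_left_eq_right _ u v

theorem specProj_specProj {T : E →ₗ[ℂ] E} (hT : T.IsSymmetric) (z w : ℝ≥0) (u : E) :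
    specProj T z (specProj T w u) = if z = w then specProj T w u else 0 :=
  specProj_of_eigen hT (apply_specProj T w u) z

theorem inner_specProj_specProj {T : E →ₗ[ℂ] E} (hT : T.IsSymmetric) (z w : ℝ≥0) (u : E) :
    inner ℂ (specProj T z u) (specProj T w u) =
      if z = w then ((‖specProj T z u‖ ^ 2 : ℝ) : ℂ) else 0 := by
  split_ifs with h
  · subst h
    rw [inner_self_eq_norm_sq_to_K]
    simp
  · rw [inner_specProj_left, specProj_specProj hT, if_neg h, inner_zero_right]

theorem inner_specProj_self {T : E →ₗ[ℂ] E} (hT : T.IsSymmetric) (z : ℝ≥0) (u : E) :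
    inner ℂ (specProj T z u) u = ((‖specProj T z u‖ ^ 2 : ℝ) : ℂ) := by
  have := inner_specProj_specProj hT z z u
  rwa [if_pos rfl, ← inner_specProj_left, specProj_specProj hT, if_pos rfl] at this

/-- Spectral decomposition of a positive operator. -/
theorem exists_sum_specProj {T : E →ₗ[ℂ] E} (hT : T.IsPositive) :
    ∃ F : Finset ℝ≥0, ∀ u, ∑ z ∈ F, specProj T z u = u := by
  let b := hT.isSymmetric.eigenvectorBasis rfl
  let l : Fin (Module.finrank ℂ E) → ℝ≥0 := fun i => ⟨_, hT.nonneg_eigenvalues rfl i⟩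
  refine ⟨Finset.univ.image l, fun u => ?_⟩
  have hlin : ∑ z ∈ Finset.univ.image l, (specProj T z : E →ₗ[ℂ] E) = LinearMap.id := by
    refine b.toBasis.ext fun i => ?_
    have hb : T (b i) = (((l i : ℝ≥0) : ℝ) : ℂ) • b i :=
      hT.isSymmetric.apply_eigenvectorBasis rfl i
    have hmem : l i ∈ Finset.univ.image l := Finset.mem_image_of_mem _ (Finset.mem_univ i)
    simp [specProj_of_eigen hT.isSymmetric hb, hmem]
  simpa using congrArg (fun f : E →ₗ[ℂ] E => f u) hlin

/-- Only the components of this one `u` must be covered, so `Y` can be the support of a line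
function instead of the whole spectrum. -/
theorem sum_specProj {T : E →ₗ[ℂ] E} (hT : T.IsPositive) {Y : Finset ℝ≥0} {u : E}
    (hY : ∀ z ∉ Y, specProj T z u = 0) : ∑ z ∈ Y, specProj T z u = u := by
  obtain ⟨F, hF⟩ := exists_sum_specProj hT
  have hFz : ∀ z ∉ F, specProj T z u = 0 := fun z hz => by
    conv_lhs => rw [← hF u]
    rw [map_sum]
    refine Finset.sum_eq_zero fun w hw => ?_
    rw [specProj_specProj hT.isSymmetric, if_neg]
    rintro rfl
    exact hz hw
  conv_rhs => rw [← hF u]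
  rw [Finset.sum_subset (Finset.subset_union_left (s₂ := F)) fun z _ hz => hY z hz,
    Finset.sum_subset (Finset.subset_union_right (s₁ := Y)) fun z _ hz => hFz z hz]

theorem norm_sq_eq_sum_specProj {T : E →ₗ[ℂ] E} (hT : T.IsPositive) {Y : Finset ℝ≥0} {u : E}
    (hY : ∀ z ∉ Y, specProj T z u = 0) : ‖u‖ ^ 2 = ∑ z ∈ Y, ‖specProj T z u‖ ^ 2 := by
  have h : inner ℂ (∑ z ∈ Y, specProj T z u) u = ((‖u‖ ^ 2 : ℝ) : ℂ) := by
    rw [sum_specProj hT hY, inner_self_eq_norm_sq_to_K]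
    simp
  simp_rw [sum_inner, inner_specProj_self hT.isSymmetric] at h
  exact_mod_cast h.symm

/-- The spectrum is finite. Enlarging an arbitrary `Y` by it turns the Bessel-type bounds below into
identities over `F` with nonnegative terms dropped. -/
theorem exists_superset_specProj {T : E →ₗ[ℂ] E} (hT : T.IsPositive) (Y : Finset ℝ≥0) :
    ∃ F, Y ⊆ F ∧ ∀ u, ∀ z ∉ F, specProj T z u = 0 := by
  obtain ⟨F, hF⟩ := exists_sum_specProj hT
  refine ⟨Y ∪ F, Finset.subset_union_left, fun u z hz => ?_⟩
  conv_lhs => rw [← hF u]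
  rw [map_sum]
  refine Finset.sum_eq_zero fun w hw => ?_
  rw [specProj_specProj hT.isSymmetric, if_neg]
  rintro rfl
  exact hz (Finset.mem_union_right _ hw)

theorem sum_norm_sq_specProj_le {T : E →ₗ[ℂ] E} (hT : T.IsPositive) (Y : Finset ℝ≥0) (u : E) :
    ∑ z ∈ Y, ‖specProj T z u‖ ^ 2 ≤ ‖u‖ ^ 2 := by
  obtain ⟨F, hYF, hF⟩ := exists_superset_specProj hT Y
  rw [norm_sq_eq_sum_specProj hT (hF u)]
  exact Finset.sum_le_sum_of_subset_of_nonneg hYF fun _ _ _ => by positivity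

theorem sum_mul_norm_sq_specProj_le {T : E →ₗ[ℂ] E} (hT : T.IsPositive) (Y : Finset ℝ≥0) (u : E) :
    ∑ z ∈ Y, (z : ℝ) * ‖specProj T z u‖ ^ 2 ≤ (inner ℂ (T u) u).re := by
  obtain ⟨F, hYF, hF⟩ := exists_superset_specProj hT Y
  have h : inner ℂ (T u) u = ((∑ z ∈ F, (z : ℝ) * ‖specProj T z u‖ ^ 2 : ℝ) : ℂ) := by
    conv_lhs => rw [← sum_specProj hT (hF u), map_sum, sum_specProj hT (hF u)]
    simp_rw [sum_inner, apply_specProj, inner_smul_left, inner_specProj_self hT.isSymmetric]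
    simp
  rw [h, Complex.ofReal_re]
  exact Finset.sum_le_sum_of_subset_of_nonneg hYF fun _ _ _ => by positivity

theorem apply_specVec (T : E →ₗ[ℂ] E) (ψ : E) (z : ℝ≥0) :
    T (specVec T ψ z) = ((z : ℝ) : ℂ) • specVec T ψ z := by
  rw [specVec, map_smul, apply_specProj, smul_comm]

theorem specProj_specVec {T : E →ₗ[ℂ] E} (hT : T.IsSymmetric) (ψ : E) (z : ℝ≥0) :
    specProj T z (specVec T ψ z) = specVec T ψ z := by
  rw [specVec, map_smul, specProj_specProj hT, if_pos rfl]

/-- The norm is below `1` only when the component vanishes: then `specVec` is `0` by the convention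
`0⁻¹ = 0`. -/
theorem norm_specVec_le (T : E →ₗ[ℂ] E) (ψ : E) (z : ℝ≥0) : ‖specVec T ψ z‖ ≤ 1 := by
  rw [specVec, norm_smul, Complex.norm_real, norm_inv, norm_norm]
  exact inv_mul_le_one

theorem norm_specProj_smul_specVec (T : E →ₗ[ℂ] E) (ψ : E) (z : ℝ≥0) :
    ((‖specProj T z ψ‖ : ℝ) : ℂ) • specVec T ψ z = specProj T z ψ := by
  rcases eq_or_ne (specProj T z ψ) 0 with h | h
  · simp [h]
  · rw [specVec, smul_smul, ← Complex.ofReal_mul, mul_inv_cancel₀ (norm_ne_zero_iff.2 h)]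
    simp

theorem inner_specVec_specVec {T : E →ₗ[ℂ] E} (hT : T.IsSymmetric) (ψ : E) {z : ℝ≥0}
    (hz : specProj T z ψ ≠ 0) (w : ℝ≥0) :
    inner ℂ (specVec T ψ z) (specVec T ψ w) = if z = w then 1 else 0 := by
  rw [specVec, specVec, inner_smul_left, inner_smul_right, inner_specProj_specProj hT]
  split_ifs with h
  · subst h
    have := norm_ne_zero_iff.2 hz
    simp only [Complex.conj_ofReal]
    norm_cast
    field_simp
  · simp

theorem inner_specVec_self {T : E →ₗ[ℂ] E} (hT : T.IsSymmetric) (ψ : E) (z : ℝ≥0) :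
    inner ℂ (specVec T ψ z) ψ = ((‖specProj T z ψ‖ : ℝ) : ℂ) := by
  rw [specVec, inner_smul_left, inner_specProj_self hT]
  rcases eq_or_ne (specProj T z ψ) 0 with h | h
  · simp [h]
  · have := norm_ne_zero_iff.2 h
    simp only [Complex.conj_ofReal]
    norm_cast
    field_simp

/-- `specVec T ψ z` lies in the eigenspace, so it sees only the projection of `u`. A bound by `1` on
its norm suffices, so vanishing components of `ψ` are harmless on this side. -/
theorem norm_inner_specVec_le {T : E →ₗ[ℂ] E} (hT : T.IsSymmetric) (ψ u : E) (z : ℝ≥0) :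
    ‖inner ℂ (specVec T ψ z) u‖ ≤ ‖specProj T z u‖ := by
  rw [← specProj_specVec hT, inner_specProj_left]
  exact (norm_inner_le_norm _ _).trans
    (mul_le_of_le_one_left (norm_nonneg _) (norm_specVec_le T ψ z))

/-- Overlaps of the spectral components of `ψ` for `0 ≤ T ≤ T'` do not increase the energy. -/
theorem sum_norm_inner_specVec_le {T T' : E →ₗ[ℂ] E} (hT : T.IsPositive) (hT' : T'.IsPositive)
    (hle : (T' - T).IsPositive) (ψ : E) {ι : Type*} (A B : Finset ι) (f : ι → ℝ≥0)
    (hA : Set.InjOn f A) (hB : Set.InjOn f B) (hB0 : ∀ s ∈ B, specProj T' (f s) ψ ≠ 0)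
    (v : ι → ℂ) :
    ∑ t ∈ A, ‖∑ s ∈ B, inner ℂ (specVec T ψ (f t)) (specVec T' ψ (f s)) * v s‖ ^ 2 ≤
        ∑ s ∈ B, ‖v s‖ ^ 2 ∧
      ∑ t ∈ A, (f t : ℝ) *
          ‖∑ s ∈ B, inner ℂ (specVec T ψ (f t)) (specVec T' ψ (f s)) * v s‖ ^ 2 ≤
        ∑ s ∈ B, (f s : ℝ) * ‖v s‖ ^ 2 := by
  -- `u` has coordinates `v` in the orthonormal system of components of `ψ` under `T'`; both claims
  -- are bounds on the components of `u` under `T`.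
  set u : E := ∑ s ∈ B, v s • specVec T' ψ (f s) with hu
  have hin : ∀ t, ∑ s ∈ B, inner ℂ (specVec T ψ (f t)) (specVec T' ψ (f s)) * v s =
      inner ℂ (specVec T ψ (f t)) u := fun t => by
    rw [hu, inner_sum]
    exact Finset.sum_congr rfl fun s _ => by rw [inner_smul_right, mul_comm]
  have hgen : ∀ c : ι → ℂ, inner ℂ (∑ s ∈ B, c s • specVec T' ψ (f s)) u =
      ∑ s ∈ B, starRingEnd ℂ (c s) * v s := fun c => by
    rw [hu, sum_inner]
    refine Finset.sum_congr rfl fun s hs => ?_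
    rw [inner_smul_left, inner_sum, Finset.sum_eq_single_of_mem s hs]
    · rw [inner_smul_right, inner_specVec_specVec hT'.isSymmetric ψ (hB0 s hs), if_pos rfl, mul_one]
    · intro r hr hrs
      rw [inner_smul_right, inner_specVec_specVec hT'.isSymmetric ψ (hB0 s hs),
        if_neg fun h => hrs (hB hr hs h.symm), mul_zero]
  have hnorm : ‖u‖ ^ 2 = ∑ s ∈ B, ‖v s‖ ^ 2 := by
    have h := hgen v
    rw [← hu, inner_self_eq_norm_sq_to_K] at h
    simp_rw [Complex.conj_mul'] at h
    refine Complex.ofReal_injective ?_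
    push_cast
    exact h
  have henergy : (inner ℂ (T' u) u).re = ∑ s ∈ B, (f s : ℝ) * ‖v s‖ ^ 2 := by
    have h := hgen fun s => ((f s : ℝ) : ℂ) * v s
    have hTu : T' u = ∑ s ∈ B, (((f s : ℝ) : ℂ) * v s) • specVec T' ψ (f s) := by
      rw [hu, map_sum]
      refine Finset.sum_congr rfl fun s _ => ?_
      rw [map_smul, apply_specVec, smul_smul, mul_comm]
    rw [hTu, h, Complex.re_sum]
    refine Finset.sum_congr rfl fun s _ => ?_
    rw [map_mul, Complex.conj_ofReal, mul_assoc, Complex.conj_mul']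
    norm_cast
  -- The only place where the operator inequality enters.
  have hmono : (inner ℂ (T u) u).re ≤ (inner ℂ (T' u) u).re := by
    have := hle.re_inner_nonneg_left u
    rw [LinearMap.sub_apply, inner_sub_left] at this
    simpa using this
  simp_rw [hin]
  constructor
  · calc ∑ t ∈ A, ‖inner ℂ (specVec T ψ (f t)) u‖ ^ 2
        ≤ ∑ t ∈ A, ‖specProj T (f t) u‖ ^ 2 := by
          gcongr with t
          exact norm_inner_specVec_le hT.isSymmetric ψ u _
      _ = ∑ z ∈ A.image f, ‖specProj T z u‖ ^ 2 :=
          (Finset.sum_image (f := fun z => ‖specProj T z u‖ ^ 2) hA).symm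
      _ ≤ ‖u‖ ^ 2 := sum_norm_sq_specProj_le hT _ u
      _ = _ := hnorm
  · calc ∑ t ∈ A, (f t : ℝ) * ‖inner ℂ (specVec T ψ (f t)) u‖ ^ 2
        ≤ ∑ t ∈ A, (f t : ℝ) * ‖specProj T (f t) u‖ ^ 2 := by
          gcongr with t
          exact norm_inner_specVec_le hT.isSymmetric ψ u _
      _ = ∑ z ∈ A.image f, (z : ℝ) * ‖specProj T z u‖ ^ 2 :=
          (Finset.sum_image (f := fun z : ℝ≥0 => (z : ℝ) * ‖specProj T z u‖ ^ 2) hA).symm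
      _ ≤ (inner ℂ (T u) u).re := sum_mul_norm_sq_specProj_le hT _ u
      _ ≤ _ := hmono.trans henergy.le

end Spectral

/-! ### Overlap matrices of EBM transitions -/

/-- A line transition expressible by matrices is given by a matrix of overlaps that maps `√h` to
`√g` and increases neither the norm nor the energy of a vector. -/
theorem EBMLine.exists_overlap {g h : ℝ≥0 → ℝ≥0} (H : EBMLine g h) :
    ∃ k : ℝ≥0 → ℝ≥0 → ℂ,
      (∀ {ι : Type} (A B : Finset ι) (f : ι → ℝ≥0), Set.InjOn f A → Set.InjOn f B →
        (∀ s ∈ B, h (f s) ≠ 0) → ∀ v : ι → ℂ,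
          ∑ t ∈ A, ‖∑ s ∈ B, k (f t) (f s) * v s‖ ^ 2 ≤ ∑ s ∈ B, ‖v s‖ ^ 2 ∧
          ∑ t ∈ A, (f t : ℝ) * ‖∑ s ∈ B, k (f t) (f s) * v s‖ ^ 2 ≤
            ∑ s ∈ B, (f s : ℝ) * ‖v s‖ ^ 2) ∧
      (∀ Y : Finset ℝ≥0, (∀ z ∉ Y, h z = 0) → ∀ z,
        ∑ w ∈ Y, k z w * (√(h w : ℝ) : ℂ) = (√(g z : ℝ) : ℂ)) ∧
      ∀ X Y : Finset ℝ≥0, (∀ z ∉ X, g z = 0) → (∀ z ∉ Y, h z = 0) →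
        ∑ z ∈ X, g z = ∑ w ∈ Y, h w := by
  obtain ⟨d, G, H', ψ, hG, hHG, hg, hh⟩ := H
  have hT := Matrix.isPositive_toEuclideanLin_iff.2 hG
  have hle := Matrix.isPositive_toEuclideanLin_iff.2 hHG
  have hT' : (Matrix.toEuclideanLin H').IsPositive := by
    refine Matrix.isPositive_toEuclideanLin_iff.2 ?_
    simpa using hG.add hHG
  rw [map_sub] at hle
  have prob : ∀ {Z : Matrix (Fin d) (Fin d) ℂ}, (Matrix.toEuclideanLin Z).IsPositive → ∀ z,
      Prob Z ψ z = ‖specProj (Matrix.toEuclideanLin Z) z ψ‖ ^ 2 := fun hZ z => by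
    change (inner ℂ ψ (specProj _ z ψ)).re = _
    rw [← inner_specProj_left, inner_specProj_self hZ.isSymmetric, Complex.ofReal_re]
  have hg' : ∀ z, (g z : ℝ) = ‖specProj (Matrix.toEuclideanLin G) z ψ‖ ^ 2 := fun z => by
    rw [hg, prob hT]
  have hh' : ∀ z, (h z : ℝ) = ‖specProj (Matrix.toEuclideanLin H') z ψ‖ ^ 2 := fun z => by
    rw [hh, prob hT']
  have hg0 : ∀ z, g z = 0 ↔ specProj (Matrix.toEuclideanLin G) z ψ = 0 := fun z => by
    rw [← NNReal.coe_eq_zero, hg']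
    simp
  have hh0 : ∀ z, h z = 0 ↔ specProj (Matrix.toEuclideanLin H') z ψ = 0 := fun z => by
    rw [← NNReal.coe_eq_zero, hh']
    simp
  refine ⟨fun z w => inner ℂ (specVec (Matrix.toEuclideanLin G) ψ z)
    (specVec (Matrix.toEuclideanLin H') ψ w), ?_, ?_, ?_⟩
  · intro ι A B f hA hB hB0 v
    exact sum_norm_inner_specVec_le hT hT' hle ψ A B f hA hB (fun s hs => (hh0 _).not.1 (hB0 s hs)) v
  · intro Y hY z
    have hs : ∀ w, (√(h w : ℝ) : ℂ) = ((‖specProj (Matrix.toEuclideanLin H') w ψ‖ : ℝ) : ℂ) :=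
      fun w => by rw [hh', Real.sqrt_sq (norm_nonneg _)]
    have hsum : ∑ w ∈ Y, ((‖specProj (Matrix.toEuclideanLin H') w ψ‖ : ℝ) : ℂ) •
        specVec (Matrix.toEuclideanLin H') ψ w = ψ := by
      simp_rw [norm_specProj_smul_specVec]
      exact sum_specProj hT' fun w hw => (hh0 w).1 (hY w hw)
    rw [hg', Real.sqrt_sq (norm_nonneg _), ← inner_specVec_self hT.isSymmetric]
    have h := congrArg (inner ℂ (specVec (Matrix.toEuclideanLin G) ψ z)) hsum
    rw [inner_sum] at h
    rw [← h]
    refine Finset.sum_congr rfl fun w _ => ?_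
    rw [inner_smul_right, hs, mul_comm]
  · intro X Y hX hY
    rw [← NNReal.coe_inj]
    push_cast
    simp_rw [hg', hh']
    rw [← norm_sq_eq_sum_specProj hT fun z hz => (hg0 z).1 (hX z hz),
      ← norm_sq_eq_sum_specProj hT' fun z hz => (hh0 z).1 (hY z hz)]

/-- A matrix of overlaps that maps the amplitudes of the frame `q` to those of `p` along the lines
on which the second coordinate of `e` is constant, and that increases neither the norm nor the
energy, given by the first coordinate of `e`. -/
structure Transition (e : ℝ≥0 × ℝ≥0 ≃ ℝ≥0 × ℝ≥0) (p q : Frame) where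
  K : p.support → q.support → ℂ
  norm_le : ∀ v : q.support → ℂ,
    ∑ t : p.support, ‖∑ s : q.support, K t s * v s‖ ^ 2 ≤ ∑ s : q.support, ‖v s‖ ^ 2
  energy_le : ∀ v : q.support → ℂ,
    ∑ t : p.support, ((e t).1 : ℝ) * ‖∑ s : q.support, K t s * v s‖ ^ 2 ≤
      ∑ s : q.support, ((e s).1 : ℝ) * ‖v s‖ ^ 2
  line : ∀ (t : p.support) (s : q.support), (e t).2 ≠ (e s).2 → K t s = 0
  map_sqrt : ∀ t : p.support,
    ∑ s : q.support, K t s * (√(q (s : ℝ≥0 × ℝ≥0) : ℝ) : ℂ) = (√(p (t : ℝ≥0 × ℝ≥0) : ℝ) : ℂ)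
  total : ∀ y, ∑ t ∈ p.support with (e t).2 = y, p t = ∑ s ∈ q.support with (e s).2 = y, q s

/-- The matrix is block diagonal along the fibres of `f`, so a bound on each block adds up to a
bound on the whole. -/
theorem sum_norm_sum_fiber_le {P Y : Type} [DecidableEq Y] (A B : Finset P) (f : P → Y)
    (w : P → ℝ) (k : P → P → ℂ) (v : P → ℂ)
    (h : ∀ y, ∑ t ∈ A with f t = y, w t * ‖∑ s ∈ B with f s = y, k t s * v s‖ ^ 2 ≤
      ∑ s ∈ B with f s = y, w s * ‖v s‖ ^ 2) :
    ∑ t ∈ A, w t * ‖∑ s ∈ B, (if f t = f s then k t s else 0) * v s‖ ^ 2 ≤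
      ∑ s ∈ B, w s * ‖v s‖ ^ 2 := by
  rw [← Finset.sum_fiberwise_of_maps_to (s := A) (t := A.image f ∪ B.image f) (g := f)
      fun t ht => Finset.mem_union_left _ (Finset.mem_image_of_mem f ht),
    ← Finset.sum_fiberwise_of_maps_to (s := B) (t := A.image f ∪ B.image f) (g := f)
      fun t ht => Finset.mem_union_right _ (Finset.mem_image_of_mem f ht)]
  refine Finset.sum_le_sum fun y _ => (le_of_eq ?_).trans (h y)
  refine Finset.sum_congr rfl fun t ht => ?_
  rw [Finset.mem_filter] at ht
  simp only [ht.2, Finset.sum_filter, ite_mul, zero_mul, eq_comm]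

/-- The equivalence `e` puts the moving coordinate first, which treats both directions at once. The
overlap matrices of the separate lines are the diagonal blocks of `K`. -/
theorem exists_transition {e : ℝ≥0 × ℝ≥0 ≃ ℝ≥0 × ℝ≥0} {p q : Frame}
    (H : ∀ y, EBMLine (fun x => p (e.symm (x, y))) (fun x => q (e.symm (x, y)))) :
    Nonempty (Transition e p q) := by
  choose k hk hmap htot using fun y => (H y).exists_overlap
  have hact : ∀ {y : ℝ≥0} {s : ℝ≥0 × ℝ≥0}, (e s).2 = y → e.symm ((e s).1, y) = s := by
    rintro _ s rfl
    simp
  have hinj : ∀ (r : Frame) (y : ℝ≥0),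
      Set.InjOn (fun s => (e s).1) (r.support.filter fun s => (e s).2 = y : Finset (ℝ≥0 × ℝ≥0)) := by
    intro r y s hs t ht hst
    simp only [Finset.coe_filter, Set.mem_ofPred_eq] at hs ht
    rw [← hact hs.2, ← hact ht.2]
    simp only at hst
    rw [hst]
  have hout : ∀ (r : Frame) (y : ℝ≥0),
      ∀ z ∉ (r.support.filter fun s => (e s).2 = y).image (fun s => (e s).1),
        r (e.symm (z, y)) = 0 := by
    intro r y z hz
    by_contra hne
    refine hz (Finset.mem_image.2 ⟨e.symm (z, y), ?_, by simp⟩)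
    simp [hne]
  have key : ∀ v : ℝ≥0 × ℝ≥0 → ℂ, ∀ y, _ := fun v y =>
    hk y (p.support.filter fun s => (e s).2 = y) (q.support.filter fun s => (e s).2 = y)
      (fun s => (e s).1) (hinj p y) (hinj q y) (fun s hs => by
        rw [Finset.mem_filter, Finsupp.mem_support_iff] at hs
        simpa only [hact hs.2] using hs.1) v
  let kk : ℝ≥0 × ℝ≥0 → ℝ≥0 × ℝ≥0 → ℂ := fun t s => k (e t).2 (e t).1 (e s).1
  have hline : ∀ y (v : ℝ≥0 × ℝ≥0 → ℂ) (w : ℝ≥0 × ℝ≥0 → ℝ),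
      ∑ t ∈ p.support with (e t).2 = y,
          w t * ‖∑ s ∈ q.support with (e s).2 = y, kk t s * v s‖ ^ 2 =
        ∑ t ∈ p.support with (e t).2 = y,
          w t * ‖∑ s ∈ q.support with (e s).2 = y, k y (e t).1 (e s).1 * v s‖ ^ 2 := by
    intro y v w
    refine Finset.sum_congr rfl fun t ht => ?_
    rw [Finset.mem_filter] at ht
    simp only [kk, ht.2]
  have hsum : ∀ (v : q.support → ℂ) (w : ℝ≥0 × ℝ≥0 → ℝ),
      (∀ (v : ℝ≥0 × ℝ≥0 → ℂ) y,
        ∑ t ∈ p.support with (e t).2 = y,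
          w t * ‖∑ s ∈ q.support with (e s).2 = y, k y (e t).1 (e s).1 * v s‖ ^ 2 ≤
        ∑ s ∈ q.support with (e s).2 = y, w s * ‖v s‖ ^ 2) →
      ∑ t : p.support, w t *
          ‖∑ s : q.support, (if (e t).2 = (e s).2 then kk t s else 0) * v s‖ ^ 2 ≤
        ∑ s : q.support, w s * ‖v s‖ ^ 2 := by
    intro v w hw
    have hv : ∀ s : q.support, v s = Function.extend Subtype.val v 0 (s : ℝ≥0 × ℝ≥0) := fun s =>
      (Subtype.val_injective.extend_apply v 0 s).symm
    have := sum_norm_sum_fiber_le p.support q.support (fun s => (e s).2) w kk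
      (Function.extend Subtype.val v 0) fun y => (hline y _ w).trans_le (hw _ y)
    simp_rw [hv]
    rw [← Finset.sum_coe_sort p.support, ← Finset.sum_coe_sort q.support] at this
    simpa only [← Finset.sum_coe_sort q.support] using this
  refine ⟨⟨fun t s => if (e t).2 = (e s).2 then kk t s else 0, fun v => ?_, fun v => ?_, ?_, ?_,
    ?_⟩⟩
  · simpa using hsum v 1 fun v y => by simpa using (key v y).1
  · exact hsum v (fun s => (e s).1) fun v y => (key v y).2
  · intro t s hts
    exact if_neg hts
  · intro t
    have h := hmap (e t).2 _ (hout q (e t).2) (e t).1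
    rw [Finset.sum_image (hinj q _), hact rfl] at h
    rw [Finset.sum_coe_sort q.support fun s =>
      (if (e t).2 = (e s).2 then kk t s else 0) * (√(q s : ℝ) : ℂ), ← h, Finset.sum_filter]
    refine Finset.sum_congr rfl fun s _ => ?_
    by_cases hs : (e s).2 = (e t).2
    · rw [if_pos hs.symm, if_pos hs, hact hs]
    · rw [if_neg (Ne.symm hs), if_neg hs, zero_mul]
  · intro y
    have h := htot y _ _ (hout p y) (hout q y)
    rw [Finset.sum_image (hinj p y), Finset.sum_image (hinj q y)] at h
    rw [Finset.sum_congr rfl fun s hs => ?_, h]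
    · refine Finset.sum_congr rfl fun s hs => ?_
      rw [hact (Finset.mem_filter.1 hs).2]
    · rw [hact (Finset.mem_filter.1 hs).2]

theorem EBMHorizontal.exists_transition {p q : Frame} (h : EBMHorizontal p q) :
    Nonempty (Transition (Equiv.refl _) p q) :=
  PenWCF.exists_transition h

theorem EBMVertical.exists_transition {p q : Frame} (h : EBMVertical p q) :
    Nonempty (Transition (Equiv.prodComm _ _) p q) :=
  PenWCF.exists_transition h

/-- The trivial transition. -/
def Transition.refl (e : ℝ≥0 × ℝ≥0 ≃ ℝ≥0 × ℝ≥0) (p : Frame) : Transition e p p where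
  K t s := if t = s then 1 else 0
  norm_le v := by simp
  energy_le v := by simp
  line t s h := if_neg fun hts => h (by rw [hts])
  map_sqrt t := by simp
  total y := rfl

variable {e : ℝ≥0 × ℝ≥0 ≃ ℝ≥0 × ℝ≥0} {p q : Frame}

/-- A transition does not change the set of occupied lines. -/
theorem Transition.image_eq (τ : Transition e p q) :
    p.support.image (fun s => (e s).2) = q.support.image (fun s => (e s).2) := by
  -- Weights are nonnegative, so a line is occupied exactly when its total weight, which is
  -- conserved, is nonzero.
  have aux : ∀ (r : Frame) (y : ℝ≥0), y ∈ r.support.image (fun s => (e s).2) ↔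
      ∑ s ∈ r.support with (e s).2 = y, r s ≠ 0 := by
    intro r y
    rw [Ne, Finset.sum_eq_zero_iff]
    simp only [Finset.mem_image, Finset.mem_filter, Finsupp.mem_support_iff]
    push Not
    exact ⟨fun ⟨s, h1, h2⟩ => ⟨s, ⟨h1, h2⟩, h1⟩, fun ⟨s, h, _⟩ => ⟨s, h⟩⟩
  ext y
  rw [aux, aux, τ.total]

/-! ### From contractions to unitaries -/

section Isometry

theorem star_dotProduct_self_eq_sum {X : Type} [Fintype X] (v : X → ℂ) :
    star v ⬝ᵥ v = ((∑ x, ‖v x‖ ^ 2 : ℝ) : ℂ) := by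
  simp [dotProduct, Complex.conj_mul']

theorem star_dotProduct_diagonal_mulVec {X : Type} [Fintype X] [DecidableEq X] (w : X → ℝ)
    (v : X → ℂ) : star v ⬝ᵥ (diagonal (fun x => (w x : ℂ)) *ᵥ v) =
      ((∑ x, w x * ‖v x‖ ^ 2 : ℝ) : ℂ) := by
  simp only [dotProduct, mulVec_diagonal, Pi.star_apply, RCLike.star_def]
  push_cast
  refine Finset.sum_congr rfl fun x _ => ?_
  rw [mul_left_comm, Complex.conj_mul']

theorem star_dotProduct_conj_mulVec {X Y : Type} [Fintype X] [Fintype Y] (C : Matrix Y X ℂ)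
    (A : Matrix Y Y ℂ) (v : X → ℂ) :
    star v ⬝ᵥ ((Cᴴ * A * C) *ᵥ v) = star (C *ᵥ v) ⬝ᵥ (A *ᵥ (C *ᵥ v)) := by
  rw [star_mulVec, ← mulVec_mulVec, ← mulVec_mulVec, dotProduct_mulVec]

/-- Passes from energy bounds on vectors to the operator inequalities that duality needs. -/
theorem posSemidef_diagonal_sub {X Y : Type} [Fintype X] [DecidableEq X] [Fintype Y]
    [DecidableEq Y] (C : Matrix Y X ℂ) (w : X → ℝ) (w' : Y → ℝ)
    (h : ∀ v : X → ℂ, ∑ y, w' y * ‖(C *ᵥ v) y‖ ^ 2 ≤ ∑ x, w x * ‖v x‖ ^ 2) :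
    (diagonal (fun x => (w x : ℂ)) - Cᴴ * diagonal (fun y => (w' y : ℂ)) * C).PosSemidef := by
  have hd : ∀ {X : Type} [DecidableEq X] (w : X → ℝ),
      (diagonal (fun x => (w x : ℂ)) : Matrix X X ℂ).IsHermitian := fun w =>
    isHermitian_diagonal_of_self_adjoint _ (funext fun x => Complex.conj_ofReal (w x))
  refine PosSemidef.of_dotProduct_mulVec_nonneg
    ((hd w).sub (isHermitian_conjTranspose_mul_mul C (hd w'))) fun v => ?_
  rw [sub_mulVec, dotProduct_sub, star_dotProduct_conj_mulVec, star_dotProduct_diagonal_mulVec,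
    star_dotProduct_diagonal_mulVec, ← Complex.ofReal_sub]
  exact_mod_cast sub_nonneg.2 (h v)

open scoped MatrixOrder in
theorem _root_.Matrix.PosSemidef.exists_eq_conjTranspose_mul_self {X : Type} [Fintype X]
    [DecidableEq X] {A : Matrix X X ℂ} (hA : A.PosSemidef) : ∃ B : Matrix X X ℂ, A = Bᴴ * B :=
  CStarAlgebra.nonneg_iff_eq_star_mul_self.mp (nonneg_iff_posSemidef.2 hA)

/-- A contraction is a block of an isometry. -/
theorem exists_isometry_completion {S T : Type} [Fintype S] [DecidableEq S] [Fintype T]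
    [DecidableEq T] (K : Matrix T S ℂ)
    (h : ∀ v : S → ℂ, ∑ t, ‖(K *ᵥ v) t‖ ^ 2 ≤ ∑ s, ‖v s‖ ^ 2) :
    ∃ R : Matrix S S ℂ, ∀ v : S → ℂ,
      ∑ t, ‖(K *ᵥ v) t‖ ^ 2 + ∑ s, ‖(R *ᵥ v) s‖ ^ 2 = ∑ s, ‖v s‖ ^ 2 := by
  have hpsd := posSemidef_diagonal_sub K (fun _ => 1) (fun _ => 1) (by simpa using h)
  simp only [Complex.ofReal_one, diagonal_one] at hpsd
  -- $R^*R=1-K^*K$ records exactly the norm that $K$ loses.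
  obtain ⟨R, hR⟩ := hpsd.exists_eq_conjTranspose_mul_self
  refine ⟨R, fun v => ?_⟩
  have := congrArg (fun M => star v ⬝ᵥ (M *ᵥ v)) hR
  simp only [sub_mulVec, dotProduct_sub, star_dotProduct_conj_mulVec, one_mulVec] at this
  rw [← Matrix.mul_one Rᴴ, star_dotProduct_conj_mulVec, one_mulVec, star_dotProduct_self_eq_sum,
    star_dotProduct_self_eq_sum, star_dotProduct_self_eq_sum, sub_eq_iff_eq_add] at this
  rw [add_comm]
  exact_mod_cast this.symm

/-- By injectivity each `y` receives at most one term of the inner sum. -/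
theorem sum_mul_norm_sum_ite {J Y : Type} [Fintype J] [Fintype Y] [DecidableEq Y] {f : J → Y}
    (hf : f.Injective) (γ : J → ℂ) (w : Y → ℝ) :
    ∑ y, w y * ‖∑ j, γ j * (if y = f j then 1 else 0)‖ ^ 2 = ∑ j, w (f j) * ‖γ j‖ ^ 2 := by
  classical
  have hin : ∀ i, ∑ j, γ j * (if f i = f j then 1 else 0) = γ i := fun i => by
    simp [hf.eq_iff]
  rw [← Finset.sum_subset (Finset.subset_univ (Finset.univ.image f)), Finset.sum_image hf.injOn]
  · simp_rw [hin]
  · intro y _ hy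
    have : ∀ j, y ≠ f j := fun j hj => hy (Finset.mem_image.2 ⟨j, Finset.mem_univ j, hj.symm⟩)
    simp [this]

/-- An isometry between spans of basis vectors extends to a unitary. -/
theorem exists_unitary_extension {S J Y : Type} [Fintype S] [DecidableEq S] [Fintype J]
    [Fintype Y] [DecidableEq Y] {c : S → Y} (hc : c.Injective) {f : J → Y} (hf : f.Injective)
    (W : Matrix J S ℂ) (hW : ∀ v : S → ℂ, ∑ j, ‖(W *ᵥ v) j‖ ^ 2 = ∑ s, ‖v s‖ ^ 2) :
    ∃ U ∈ Matrix.unitaryGroup Y ℂ, ∀ y s,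
      U y (c s) = ∑ j, W j s * (if y = f j then 1 else 0) := by
  let M : Matrix Y S ℂ := of fun y s => ∑ j, W j s * (if y = f j then 1 else 0)
  have hM : ∀ v : S → ℂ, ∀ y, (M *ᵥ v) y = ∑ j, (W *ᵥ v) j * (if y = f j then 1 else 0) := by
    intro v y
    simp only [M, mulVec, dotProduct, of_apply, Finset.sum_mul]
    rw [Finset.sum_comm]
    exact Finset.sum_congr rfl fun j _ => Finset.sum_congr rfl fun s _ => mul_right_comm _ _ _
  let L : EuclideanSpace ℂ S →ₗᵢ[ℂ] EuclideanSpace ℂ Y :=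
    { toLinearMap := Matrix.toLpLin 2 2 M
      norm_map' := fun v => by
        rw [EuclideanSpace.norm_eq, EuclideanSpace.norm_eq, ← hW]
        congr 1
        have := sum_mul_norm_sum_ite hf (W *ᵥ v) 1
        simp only [Pi.one_apply, one_mul] at this
        rw [← this]
        exact Finset.sum_congr rfl fun y _ => by rw [← hM]; rfl }
  have hon : Orthonormal ℂ fun s => L (EuclideanSpace.basisFun S ℂ s) :=
    (EuclideanSpace.basisFun S ℂ).orthonormal.comp_linearIsometry L
  have hdom : Orthonormal ℂ ((Set.range c).domRestrict
      (Function.extend c (fun s => L (EuclideanSpace.basisFun S ℂ s)) 0)) := by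
    have := hon.comp _ (Equiv.ofInjective c hc).symm.injective
    convert this using 1
    funext ⟨y, s, hs⟩
    subst hs
    simp [hc.extend_apply]
  obtain ⟨b, hb⟩ := hdom.exists_orthonormalBasis_extension_of_card_eq (by simp)
  refine ⟨(EuclideanSpace.basisFun Y ℂ).toBasis.toMatrix b,
    OrthonormalBasis.toMatrix_orthonormalBasis_mem_unitary _ _, fun y s => ?_⟩
  rw [Module.Basis.toMatrix_apply, hb _ ⟨s, rfl⟩, hc.extend_apply]
  simp [L, M]

end Isometry

/-! ### The move of the active player -/

/-- The projector onto the span of the basis vectors in the range of `c`. -/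
def rangeProj {S Y : Type} [DecidableEq Y] (c : S → Y) : Matrix Y Y ℂ :=
  diagonal ((Set.range c).indicator 1)

theorem isStarProjection_diagonal_indicator {Y : Type} [Fintype Y] [DecidableEq Y] (A : Set Y) :
    IsStarProjection (diagonal (A.indicator 1) : Matrix Y Y ℂ) := by
  classical
  refine ⟨?_, isHermitian_diagonal_of_self_adjoint _ (funext fun y => ?_)⟩
  · rw [IsIdempotentElem, diagonal_mul_diagonal]
    congr 1
    funext y
    by_cases h : y ∈ A <;> simp [h]
  · by_cases h : y ∈ A <;> simp [h]

theorem isStarProjection_rangeProj {S Y : Type} [Fintype Y] [DecidableEq Y] (c : S → Y) :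
    IsStarProjection (rangeProj c) :=
  isStarProjection_diagonal_indicator _

/-- After the check only the columns of `U` at codes matter, which is why the other columns may be
arbitrary. -/
theorem mul_rangeProj_mulVec {S Y : Type} [Fintype S] [Fintype Y] [DecidableEq Y] {c : S → Y}
    (hc : c.Injective) (U : Matrix Y Y ℂ) (u : Y → ℂ) (y : Y) :
    ((U * rangeProj c) *ᵥ u) y = ∑ s, U y (c s) * u (c s) := by
  classical
  rw [← mulVec_mulVec, rangeProj, mulVec, dotProduct,
    ← Finset.sum_subset (Finset.subset_univ (Finset.univ.image c)), Finset.sum_image hc.injOn]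
  · simp [mulVec_diagonal]
  · intro y' _ hy'
    have : y' ∉ Set.range c := by simpa using hy'
    simp [mulVec_diagonal, this]

/-- The amplitude of the honest state of a frame `r`: the active player and the message hold the
code `c s` of the point `s`, the other player holds the code of its fixed coordinate. -/
def amplitude (e : ℝ≥0 × ℝ≥0 ≃ ℝ≥0 × ℝ≥0) (r : Frame) {Y B : Type} [DecidableEq Y] [DecidableEq B]
    (c : r.support → Y) (g : ℝ≥0 → B) (y : Y) (b : B) : ℂ :=
  ∑ s : r.support, (√(r s : ℝ) : ℂ) * (if y = c s then 1 else 0) *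
    (if b = g (e s).2 then 1 else 0)

/-- The move of the active player that realises a transition of frames: it does not increase the
dual matrix and it maps the honest state to the honest state. -/
theorem Transition.exists_unitary (τ : Transition e p q) {Y B : Type} [Fintype Y] [DecidableEq Y]
    [DecidableEq B] {c : q.support → Y} (hc : c.Injective) {c' : p.support → Y}
    {d : q.support → Y} (hf : (Sum.elim c' d).Injective) {Z Z' : Y → ℝ} (hZ0 : ∀ y, 0 ≤ Z y)
    (hZ : ∀ s, Z (c s) = (e s).1) (hZ' : ∀ t, Z' (c' t) = (e t).1) (hd : ∀ s, Z' (d s) = 0)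
    {g : ℝ≥0 → B} (hg : Set.InjOn g (q.support.image fun s => (e s).2)) :
    ∃ U ∈ Matrix.unitaryGroup Y ℂ,
      (diagonal (fun y => (Z y : ℂ)) - (U * rangeProj c)ᴴ * diagonal (fun y => (Z' y : ℂ)) *
        (U * rangeProj c)).PosSemidef ∧
      ∀ y b, ∑ y', U y y' * amplitude e q c g y' b = amplitude e p c' g y b := by
  obtain ⟨R, hR⟩ := exists_isometry_completion (of τ.K) τ.norm_le
  have hW : ∀ (v : q.support → ℂ) j, (fromRows (of τ.K) R *ᵥ v) j =
      Sum.elim (of τ.K *ᵥ v) (R *ᵥ v) j := fun v j => by rw [fromRows_mulVec]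
  -- The rows of `K` go to the codes `c'` of `p`, the rows of `R` to the discarded vectors `d`.
  obtain ⟨U, hU, hUc⟩ := exists_unitary_extension hc hf (fromRows (of τ.K) R) fun v => by
    simp_rw [hW]
    simpa using hR v
  have hUv : ∀ (v : q.support → ℂ) y, ∑ s, U y (c s) * v s =
      ∑ j, (fromRows (of τ.K) R *ᵥ v) j * (if y = Sum.elim c' d j then 1 else 0) := by
    intro v y
    simp only [hUc, mulVec, dotProduct, Finset.sum_mul]
    rw [Finset.sum_comm]
    exact Finset.sum_congr rfl fun j _ => Finset.sum_congr rfl fun s _ => mul_right_comm _ _ _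
  refine ⟨U, hU, posSemidef_diagonal_sub _ _ _ fun u => ?_, fun y b => ?_⟩
  · simp_rw [mul_rangeProj_mulVec hc]
    -- The block `R` contributes nothing, since `Z'` vanishes on `d`.
    have h1 : ∑ y, Z' y * ‖∑ s, U y (c s) * u (c s)‖ ^ 2 =
        ∑ t : p.support, ((e t).1 : ℝ) * ‖(of τ.K *ᵥ fun s => u (c s)) t‖ ^ 2 := by
      simp_rw [hUv fun s => u (c s)]
      rw [sum_mul_norm_sum_ite hf]
      simp_rw [hW]
      simp [hZ', hd]
    calc _ = _ := h1
      _ ≤ ∑ s : q.support, ((e s).1 : ℝ) * ‖u (c s)‖ ^ 2 := τ.energy_le _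
      _ = ∑ y ∈ Finset.univ.image c, Z y * ‖u y‖ ^ 2 := by
        rw [Finset.sum_image hc.injOn]
        simp [hZ]
      _ ≤ ∑ y, Z y * ‖u y‖ ^ 2 :=
        Finset.sum_le_sum_of_subset_of_nonneg (Finset.subset_univ _) fun y _ _ =>
          mul_nonneg (hZ0 y) (by positivity)
  -- `v` is the slice of $\sqrt q$ on the line whose code the other player holds as `b`; it is zero
  -- if `b` encodes no occupied line.
  · set v : q.support → ℂ := fun s =>
      (√(q s : ℝ) : ℂ) * (if b = g (e s).2 then 1 else 0) with hv
    have hlhs : ∑ y', U y y' * amplitude e q c g y' b = ∑ s, U y (c s) * v s := by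
      simp only [amplitude, Finset.mul_sum]
      rw [Finset.sum_comm]
      refine Finset.sum_congr rfl fun s _ => ?_
      rw [Finset.sum_eq_single (c s)]
      · simp [hv]
      · intro y' _ hy'
        simp [hy']
      · simp
    have hK : ∀ t : p.support, (of τ.K *ᵥ v) t =
        (√(p t : ℝ) : ℂ) * (if b = g (e t).2 then 1 else 0) := by
      intro t
      rw [← τ.map_sqrt, Finset.sum_mul]
      refine Finset.sum_congr rfl fun s _ => ?_
      by_cases h : (e t).2 = (e s).2
      · simp only [of_apply, hv, h, mul_assoc]
      · simp [τ.line t s h]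
    -- The weight of the line encoded by `b` is conserved. Hence `K` loses no norm on `v`, which
    -- forces `R v = 0`.
    have htotal : ∑ t, ‖(of τ.K *ᵥ v) t‖ ^ 2 = ∑ s, ‖v s‖ ^ 2 := by
      have hnorm : ∀ (r : Frame) (s : r.support),
          ‖(√(r s : ℝ) : ℂ) * (if b = g (e s).2 then 1 else 0)‖ ^ 2 =
            if b = g (e s).2 then (r s : ℝ) else 0 := by
        intro r s
        split_ifs <;> simp [Real.sq_sqrt]
      simp_rw [hK, hv, hnorm]
      rw [Finset.sum_coe_sort p.support fun s => if b = g (e s).2 then (p s : ℝ) else 0,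
        Finset.sum_coe_sort q.support fun s => if b = g (e s).2 then (q s : ℝ) else 0]
      by_cases hb : ∃ y ∈ q.support.image fun s => (e s).2, b = g y
      · obtain ⟨y, hy, rfl⟩ := hb
        have hiff : ∀ (r : Frame), r.support.image (fun s => (e s).2) =
            q.support.image (fun s => (e s).2) → ∀ s ∈ r.support,
            (if g y = g (e s).2 then (r s : ℝ) else 0) = if (e s).2 = y then (r s : ℝ) else 0 := by
          intro r hr s hs
          refine if_congr ⟨fun h => (hg hy ?_ h).symm, fun h => by rw [h]⟩ rfl rfl
          rw [← hr]
          exact Finset.mem_coe.2 (Finset.mem_image_of_mem _ hs)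
        rw [Finset.sum_congr rfl (hiff p τ.image_eq), Finset.sum_congr rfl (hiff q rfl),
          ← Finset.sum_filter, ← Finset.sum_filter]
        exact_mod_cast τ.total y
      · push Not at hb
        rw [Finset.sum_eq_zero fun s hs => if_neg (hb _ ?_),
          Finset.sum_eq_zero fun s hs => if_neg (hb _ (Finset.mem_image_of_mem _ hs))]
        rw [← τ.image_eq]
        exact Finset.mem_image_of_mem _ hs
    have hRv : ∀ s, (R *ᵥ v) s = 0 := by
      have h := hR v
      rw [htotal, add_eq_left, Finset.sum_eq_zero_iff_of_nonneg fun _ _ => by positivity] at h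
      exact fun s => by simpa using h s (Finset.mem_univ s)
    rw [hlhs, hUv]
    simp_rw [hW]
    simp only [Fintype.sum_sum_type, Sum.elim_inl, Sum.elim_inr, hRv, hK, zero_mul,
      Finset.sum_const_zero, add_zero, amplitude]
    exact Finset.sum_congr rfl fun t _ => mul_right_comm _ _ _

/-- The honest state passes the measurement of the active player. -/
theorem rangeProj_amplitude {r : Frame} {Y B : Type} [DecidableEq Y] [DecidableEq B]
    (c : r.support → Y) (g : ℝ≥0 → B) (y : Y) (b : B) :
    (Set.range c).indicator (1 : Y → ℂ) y * amplitude e r c g y b = amplitude e r c g y b := by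
  by_cases h : y ∈ Set.range c
  · simp [h]
  · rw [amplitude, Finset.sum_eq_zero, mul_zero]
    intro s _
    rw [if_neg fun hy => h ⟨s, hy.symm⟩, mul_zero, zero_mul]

/-! ### Traces against positive matrices -/

section Trace

variable {X : Type} [Fintype X] [DecidableEq X]

/-- With $\rho=C^*C$ the difference is the trace of the positive matrix $C(N'-N)C^*$. -/
theorem trace_mul_re_mono {N N' ρ : Matrix X X ℂ} (h : (N' - N).PosSemidef) (hρ : ρ.PosSemidef) :
    (N * ρ).trace.re ≤ (N' * ρ).trace.re := by
  obtain ⟨C, rfl⟩ := hρ.exists_eq_conjTranspose_mul_self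
  have h1 : 0 ≤ ((N' - N) * (Cᴴ * C)).trace := by
    rw [← Matrix.mul_assoc, Matrix.trace_mul_comm, ← Matrix.mul_assoc]
    exact (h.mul_mul_conjTranspose_same C).trace_nonneg
  rw [Matrix.sub_mul, trace_sub] at h1
  have := (Complex.le_def.1 h1).1
  simpa using this

theorem trace_mul_conj (N C ρ : Matrix X X ℂ) :
    (N * (C * ρ * Cᴴ)).trace = (Cᴴ * N * C * ρ).trace := by
  rw [← Matrix.mul_assoc, Matrix.trace_mul_comm]
  simp only [Matrix.mul_assoc]

/-- A cheater's channel cannot change the expectation of an observable on the honest player's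
register, since its Kraus operators commute with it. -/
theorem trace_mul_sum_conj {ι : Type} [Fintype ι] {N : Matrix X X ℂ} {C : ι → Matrix X X ℂ}
    (hcomm : ∀ k, Commute N (C k)) (hsum : ∑ k, (C k)ᴴ * C k = 1) (ρ : Matrix X X ℂ) :
    (N * ∑ k, C k * ρ * (C k)ᴴ).trace = (N * ρ).trace := by
  rw [Finset.mul_sum, trace_sum]
  simp_rw [trace_mul_conj]
  rw [← trace_sum, ← Finset.sum_mul]
  simp_rw [Matrix.mul_assoc, (hcomm _).eq, ← Matrix.mul_assoc]
  rw [← Finset.sum_mul, hsum, Matrix.one_mul]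

theorem trace_submatrix_equiv {Y : Type} [Fintype Y] (f : Y ≃ X) (N : Matrix X X ℂ) :
    (N.submatrix f f).trace = N.trace :=
  f.sum_comp fun x => N x x

theorem ketbra_posSemidef (ψ : X → ℂ) : (ketbra ψ).PosSemidef :=
  posSemidef_vecMulVec_self_star ψ

theorem trace_ketbra (ψ : X → ℂ) : (ketbra ψ).trace = ((normSq ψ : ℝ) : ℂ) := by
  simp [trace, ketbra, vecMulVec_apply, normSq, Complex.mul_conj']

theorem trace_diagonal_mul_ketbra (z : X → ℝ) (ψ : X → ℂ) :
    (diagonal (fun x => (z x : ℂ)) * ketbra ψ).trace = ((∑ x, z x * ‖ψ x‖ ^ 2 : ℝ) : ℂ) := by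
  simp [trace, ketbra, vecMulVec_apply, diagonal_mul, Complex.mul_conj']

end Trace

/-! ### Algebra of operators lifted to three registers -/

section Lifts

variable {A M B : Type} [Fintype A] [DecidableEq A] [Fintype M] [DecidableEq M]
  [Fintype B] [DecidableEq B]

theorem onAM_apply (X : Matrix (A × M) (A × M) ℂ) (s t : A × M × B) :
    (onAM X : Matrix (A × M × B) (A × M × B) ℂ) s t =
      X (s.1, s.2.1) (t.1, t.2.1) * (1 : Matrix B B ℂ) s.2.2 t.2.2 := rfl

theorem onMB_apply (X : Matrix (M × B) (M × B) ℂ) (s t : A × M × B) :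
    (onMB X : Matrix (A × M × B) (A × M × B) ℂ) s t = (1 : Matrix A A ℂ) s.1 t.1 * X s.2 t.2 := rfl

theorem onAM_mul (X Y : Matrix (A × M) (A × M) ℂ) :
    (onAM (X * Y) : Matrix (A × M × B) (A × M × B) ℂ) = onAM X * onAM Y := by
  simp only [onAM, reindex_apply, submatrix_mul_equiv, ← mul_kronecker_mul, Matrix.mul_one]

theorem onMB_mul (X Y : Matrix (M × B) (M × B) ℂ) :
    (onMB (X * Y) : Matrix (A × M × B) (A × M × B) ℂ) = onMB X * onMB Y := by
  simp only [onMB, ← mul_kronecker_mul, Matrix.mul_one]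

theorem onAM_conjTranspose (X : Matrix (A × M) (A × M) ℂ) :
    (onAM X : Matrix (A × M × B) (A × M × B) ℂ)ᴴ = onAM Xᴴ := by
  simp only [onAM, reindex_apply, conjTranspose_submatrix, conjTranspose_kronecker,
    conjTranspose_one]

theorem onMB_conjTranspose (X : Matrix (M × B) (M × B) ℂ) :
    (onMB X : Matrix (A × M × B) (A × M × B) ℂ)ᴴ = onMB Xᴴ := by
  simp only [onMB, conjTranspose_kronecker, conjTranspose_one]

theorem onAM_sum {ι : Type} (F : Finset ι) (X : ι → Matrix (A × M) (A × M) ℂ) :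
    ∑ k ∈ F, (onAM (X k) : Matrix (A × M × B) (A × M × B) ℂ) = onAM (∑ k ∈ F, X k) := by
  ext s t
  simp only [onAM_apply, Matrix.sum_apply, Finset.sum_mul]

theorem onMB_sum {ι : Type} (F : Finset ι) (X : ι → Matrix (M × B) (M × B) ℂ) :
    ∑ k ∈ F, (onMB (X k) : Matrix (A × M × B) (A × M × B) ℂ) = onMB (∑ k ∈ F, X k) := by
  ext s t
  simp only [onMB_apply, Matrix.sum_apply, Finset.mul_sum]

theorem onAM_one : (onAM 1 : Matrix (A × M × B) (A × M × B) ℂ) = 1 := by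
  simp [onAM]

theorem onMB_one : (onMB 1 : Matrix (A × M × B) (A × M × B) ℂ) = 1 := by
  simp [onMB]

theorem onAM_posSemidef {X : Matrix (A × M) (A × M) ℂ} (hX : X.PosSemidef) :
    (onAM X : Matrix (A × M × B) (A × M × B) ℂ).PosSemidef :=
  (hX.kronecker PosSemidef.one).submatrix _

theorem onMB_posSemidef {X : Matrix (M × B) (M × B) ℂ} (hX : X.PosSemidef) :
    (onMB X : Matrix (A × M × B) (A × M × B) ℂ).PosSemidef :=
  PosSemidef.one.kronecker hX

theorem onAM_sub (X Y : Matrix (A × M) (A × M) ℂ) :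
    (onAM (X - Y) : Matrix (A × M × B) (A × M × B) ℂ) = onAM X - onAM Y := by
  ext s t
  simp only [onAM_apply, Matrix.sub_apply, sub_mul]

theorem onMB_sub (X Y : Matrix (M × B) (M × B) ℂ) :
    (onMB (X - Y) : Matrix (A × M × B) (A × M × B) ℂ) = onMB X - onMB Y := by
  ext s t
  simp only [onMB_apply, Matrix.sub_apply, mul_sub]

theorem onAB_diagonal_one (z : A → ℂ) :
    (onAB (diagonal z) 1 : Matrix (A × M × B) (A × M × B) ℂ) =
      onAM (diagonal fun y => z y.1) := by
  ext ⟨a, m, b⟩ ⟨a', m', b'⟩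
  simp only [onAB, onAM_apply, kroneckerMap_apply, diagonal_apply, one_apply, Prod.mk.injEq]
  split_ifs <;> simp_all

theorem onAB_one_diagonal (z : B → ℂ) :
    (onAB 1 (diagonal z) : Matrix (A × M × B) (A × M × B) ℂ) =
      onMB (diagonal fun y => z y.2) := by
  ext ⟨a, m, b⟩ ⟨a', m', b'⟩
  simp only [onAB, onMB_apply, kroneckerMap_apply, diagonal_apply, one_apply, Prod.mk.injEq]
  split_ifs <;> simp_all

theorem commute_onAB_one_onMB (Z : Matrix A A ℂ) (X : Matrix (M × B) (M × B) ℂ) :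
    Commute (onAB Z 1 : Matrix (A × M × B) (A × M × B) ℂ) (onMB X) := by
  simp only [Commute, SemiconjBy, onAB, onMB, one_kronecker_one, ← mul_kronecker_mul,
    Matrix.mul_one, Matrix.one_mul]

theorem commute_onAB_one_onAM (Z : Matrix B B ℂ) (X : Matrix (A × M) (A × M) ℂ) :
    Commute (onAB 1 Z : Matrix (A × M × B) (A × M × B) ℂ) (onAM X) := by
  have h : (onAB 1 Z : Matrix (A × M × B) (A × M × B) ℂ) =
      reindex (Equiv.prodAssoc A M B) (Equiv.prodAssoc A M B) ((1 : Matrix (A × M) (A × M) ℂ) ⊗ₖ Z) := by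
    rw [← one_kronecker_one]
    exact (kronecker_assoc _ _ _).symm
  rw [h]
  simp only [Commute, SemiconjBy, onAM, reindex_apply, submatrix_mul_equiv, ← mul_kronecker_mul,
    Matrix.mul_one, Matrix.one_mul]

theorem onAB_add_left (X X' : Matrix A A ℂ) (Y : Matrix B B ℂ) :
    (onAB (X + X') Y : Matrix (A × M × B) (A × M × B) ℂ) = onAB X Y + onAB X' Y :=
  add_kronecker _ _ _

theorem onAB_add_right (X : Matrix A A ℂ) (Y Y' : Matrix B B ℂ) :
    (onAB X (Y + Y') : Matrix (A × M × B) (A × M × B) ℂ) = onAB X Y + onAB X Y' := by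
  simp only [onAB, kronecker_add]

theorem onAB_smul_left (r : ℂ) (X : Matrix A A ℂ) (Y : Matrix B B ℂ) :
    (onAB (r • X) Y : Matrix (A × M × B) (A × M × B) ℂ) = r • onAB X Y :=
  smul_kronecker _ _ _

theorem onAB_smul_right (r : ℂ) (X : Matrix A A ℂ) (Y : Matrix B B ℂ) :
    (onAB X (r • Y) : Matrix (A × M × B) (A × M × B) ℂ) = r • onAB X Y := by
  simp only [onAB, kronecker_smul]

end Lifts

/-! ### Weak duality -/

namespace Protocol

variable {A M B : Type} [Fintype A] [DecidableEq A] [Fintype M] [DecidableEq M]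
  [Fintype B] [DecidableEq B] (P : Protocol A M B)

theorem stateVsBob_posSemidef (S : CheatingBob M) (i : ℕ) : (P.stateVsBob S i).PosSemidef := by
  induction i with
  | zero =>
    exact (ketbra_posSemidef _).kronecker ((ketbra_posSemidef _).kronecker S.init_density.1)
  | succ i ih =>
    rw [stateVsBob]
    split_ifs
    · exact ih.mul_mul_conjTranspose_same _
    · exact posSemidef_sum _ fun k _ => ih.mul_mul_conjTranspose_same _

theorem stateVsAlice_posSemidef (S : CheatingAlice M) (i : ℕ) :
    (P.stateVsAlice S i).PosSemidef := by
  induction i with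
  | zero => exact (S.init_density.1.kronecker (ketbra_posSemidef _)).submatrix _
  | succ i ih =>
    rw [stateVsAlice]
    split_ifs
    · exact posSemidef_sum _ fun k _ => ih.mul_mul_conjTranspose_same _
    · exact ih.mul_mul_conjTranspose_same _

/-- Weak duality for a malicious Bob. -/
theorem rewardOfBob_le (Λ : ℝ≥0) (z : ℕ → A → ℝ)
    (hA : ∀ i < P.rounds, Even i → (diagonal (fun y : A × M => (z i y.1 : ℂ)) -
      (P.UA i * P.EA i)ᴴ * diagonal (fun y : A × M => (z (i + 1) y.1 : ℂ)) *
        (P.UA i * P.EA i)).PosSemidef)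
    (hB : ∀ i < P.rounds, ¬ Even i → z (i + 1) = z i)
    (hend : ((Λ : ℂ) + 1) • P.measA.proj .one + (Λ : ℂ) • P.measA.proj .zero =
      diagonal fun a => (z P.rounds a : ℂ)) (S : CheatingBob M) :
    P.rewardOfBob Λ S ≤ ∑ a, z 0 a * ‖P.initA a‖ ^ 2 := by
  let W : ℕ → Matrix (A × M × Fin S.dim) (A × M × Fin S.dim) ℂ := fun i =>
    onAB (diagonal fun a => (z i a : ℂ)) 1
  -- The expected dual value cannot grow: Alice's rounds lower it by the dual inequality, Bob's
  -- leave it unchanged.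
  have hmono : ∀ i ≤ P.rounds,
      (W i * P.stateVsBob S i).trace.re ≤ (W 0 * P.stateVsBob S 0).trace.re := by
    intro i
    induction i with
    | zero => exact fun _ => le_rfl
    | succ i ih =>
      intro hi
      refine le_trans ?_ (ih (Nat.le_of_succ_le hi))
      rw [stateVsBob]
      split_ifs with hev
      · rw [trace_mul_conj]
        refine trace_mul_re_mono ?_ (P.stateVsBob_posSemidef S i)
        simp only [W, onAB_diagonal_one]
        rw [onAM_conjTranspose, ← onAM_mul, ← onAM_mul, ← onAM_sub]
        exact onAM_posSemidef (hA i hi hev)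
      · simp only [W]
        rw [trace_mul_sum_conj (fun k => commute_onAB_one_onMB _ _), hB i hi hev]
        simp_rw [onMB_conjTranspose, ← onMB_mul]
        rw [onMB_sum, (S.move i).trace_preserving, onMB_one]
  have hreward : P.rewardOfBob Λ S = (W P.rounds * P.stateVsBob S P.rounds).trace.re := by
    simp only [W]
    rw [← hend, onAB_add_left, onAB_smul_left, onAB_smul_left, Matrix.add_mul, trace_add,
      Matrix.smul_mul, Matrix.smul_mul, trace_smul, trace_smul, rewardOfBob]
    simp [add_mul]
  have hinit : (W 0 * P.stateVsBob S 0).trace.re = ∑ a, z 0 a * ‖P.initA a‖ ^ 2 := by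
    simp only [W, stateVsBob, onAB]
    rw [← mul_kronecker_mul, ← mul_kronecker_mul, trace_kronecker, trace_kronecker,
      trace_diagonal_mul_ketbra, Matrix.one_mul, Matrix.one_mul, trace_ketbra, P.initM_norm,
      S.init_density.2]
    simp only [Complex.ofReal_one, mul_one, Complex.ofReal_re]
  rw [hreward, ← hinit]
  exact hmono _ le_rfl

/-- Weak duality for a malicious Alice. -/
theorem rewardOfAlice_le (Λ : ℝ≥0) (z : ℕ → B → ℝ)
    (hB : ∀ i < P.rounds, ¬ Even i → (diagonal (fun y : M × B => (z i y.2 : ℂ)) -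
      (P.UB i * P.EB i)ᴴ * diagonal (fun y : M × B => (z (i + 1) y.2 : ℂ)) *
        (P.UB i * P.EB i)).PosSemidef)
    (hA : ∀ i < P.rounds, Even i → z (i + 1) = z i)
    (hend : ((Λ : ℂ) + 1) • P.measB.proj .zero + (Λ : ℂ) • P.measB.proj .one =
      diagonal fun b => (z P.rounds b : ℂ)) (S : CheatingAlice M) :
    P.rewardOfAlice Λ S ≤ ∑ b, z 0 b * ‖P.initB b‖ ^ 2 := by
  let W : ℕ → Matrix (Fin S.dim × M × B) (Fin S.dim × M × B) ℂ := fun i =>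
    onAB 1 (diagonal fun b => (z i b : ℂ))
  have hmono : ∀ i ≤ P.rounds,
      (W i * P.stateVsAlice S i).trace.re ≤ (W 0 * P.stateVsAlice S 0).trace.re := by
    intro i
    induction i with
    | zero => exact fun _ => le_rfl
    | succ i ih =>
      intro hi
      refine le_trans ?_ (ih (Nat.le_of_succ_le hi))
      rw [stateVsAlice]
      split_ifs with hev
      · simp only [W]
        rw [trace_mul_sum_conj (fun k => commute_onAB_one_onAM _ _), hA i hi hev]
        simp_rw [onAM_conjTranspose, ← onAM_mul]
        rw [onAM_sum, (S.move i).trace_preserving, onAM_one]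
      · rw [trace_mul_conj]
        refine trace_mul_re_mono ?_ (P.stateVsAlice_posSemidef S i)
        simp only [W, onAB_one_diagonal]
        rw [onMB_conjTranspose, ← onMB_mul, ← onMB_mul, ← onMB_sub]
        exact onMB_posSemidef (hB i hi hev)
  have hreward : P.rewardOfAlice Λ S = (W P.rounds * P.stateVsAlice S P.rounds).trace.re := by
    simp only [W]
    rw [← hend, onAB_add_right, onAB_smul_right, onAB_smul_right, Matrix.add_mul, trace_add,
      Matrix.smul_mul, Matrix.smul_mul, trace_smul, trace_smul, rewardOfAlice]
    simp [add_mul]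
  have hinit : (W 0 * P.stateVsAlice S 0).trace.re = ∑ b, z 0 b * ‖P.initB b‖ ^ 2 := by
    -- Alice's memory and message may start entangled, so they are grouped as one factor; only Bob's
    -- register is in a known state.
    have hW : W 0 = reindex (Equiv.prodAssoc (Fin S.dim) M B) (Equiv.prodAssoc (Fin S.dim) M B)
        ((1 : Matrix (Fin S.dim × M) (Fin S.dim × M) ℂ) ⊗ₖ diagonal fun b => (z 0 b : ℂ)) := by
      rw [← one_kronecker_one]
      exact (kronecker_assoc _ _ _).symm
    rw [hW, stateVsAlice, reindex_apply, reindex_apply, submatrix_mul_equiv, ← mul_kronecker_mul,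
      Matrix.one_mul, trace_submatrix_equiv, trace_kronecker, trace_diagonal_mul_ketbra,
      S.init_density.2]
    simp only [one_mul, Complex.ofReal_re]
  rw [hreward, ← hinit]
  exact hmono _ le_rfl

end Protocol

/-! ### Lifted operators acting on state vectors -/

section Lifts

variable {A M B : Type} [Fintype A] [DecidableEq A] [Fintype M] [DecidableEq M]
  [Fintype B] [DecidableEq B]

theorem onAM_mulVec (X : Matrix (A × M) (A × M) ℂ) (ψ : A × M × B → ℂ) (a : A) (m : M) (b : B) :
    (onAM X *ᵥ ψ) (a, m, b) = ∑ y, X (a, m) y * ψ (y.1, y.2, b) := by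
  simp [mulVec, dotProduct, onAM_apply, Fintype.sum_prod_type, one_apply]

theorem onMB_mulVec (X : Matrix (M × B) (M × B) ℂ) (ψ : A × M × B → ℂ) (a : A) (m : M) (b : B) :
    (onMB X *ᵥ ψ) (a, m, b) = ∑ y, X (m, b) y * ψ (a, y) := by
  simp [mulVec, dotProduct, onMB_apply, Fintype.sum_prod_type, one_apply]

theorem onAB_diagonal_mulVec (f : A → ℂ) (g : B → ℂ) (ψ : A × M × B → ℂ) (v : A × M × B) :
    (onAB (diagonal f) (diagonal g) *ᵥ ψ) v = f v.1 * g v.2.2 * ψ v := by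
  have h : (onAB (diagonal f) (diagonal g) : Matrix (A × M × B) (A × M × B) ℂ) =
      diagonal fun v => f v.1 * g v.2.2 := by
    rw [onAB, ← diagonal_one, diagonal_kronecker_diagonal, diagonal_kronecker_diagonal]
    simp
  rw [h, mulVec_diagonal]

end Lifts

/-! ### Encoding frames in registers -/

/-- The points of a frame and their coordinates as basis vectors of a register; the basis vector
`bot` represents no coordinate. -/
structure Encoding (X : Type) [Fintype X] where
  bot : X
  coord : Finset ℝ≥0 → ℝ≥0 → X
  point : Finset (ℝ≥0 × ℝ≥0) → ℝ≥0 × ℝ≥0 → X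
  coord_injOn : ∀ Y, Y.card < Fintype.card X → Set.InjOn (coord Y) Y
  coord_ne_bot : ∀ Y, Y.card < Fintype.card X → ∀ y ∈ Y, coord Y y ≠ bot
  point_injOn : ∀ S, S.card < Fintype.card X → Set.InjOn (point S) S

/-- The size condition sits inside the existential so that one code can be chosen for every finite
set. Its strictness leaves room for `bot`. -/
theorem exists_injOn_ne {X P : Type} [Fintype X] (bot : X) (Y : Finset P) :
    ∃ f : P → X, Y.card < Fintype.card X → Set.InjOn f Y ∧ ∀ y ∈ Y, f y ≠ bot := by
  classical
  by_cases hY : Y.card < Fintype.card X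
  · obtain ⟨g⟩ : Nonempty (Y ↪ {x : X // x ≠ bot}) := by
      refine Function.Embedding.nonempty_of_card_le ?_
      rw [Fintype.card_coe, Fintype.card_subtype_compl, Fintype.card_subtype_eq]
      omega
    refine ⟨fun y => if h : y ∈ Y then g ⟨y, h⟩ else bot, fun _ => ⟨fun y hy y' hy' h => ?_,
      fun y hy => ?_⟩⟩
    · simp only [Finset.mem_coe.1 hy, Finset.mem_coe.1 hy', dif_pos] at h
      exact congrArg Subtype.val (g.injective (Subtype.ext h))
    · simp only [hy, dif_pos]
      exact (g ⟨y, hy⟩).2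
  · exact ⟨fun _ => bot, fun h => absurd h hY⟩

theorem exists_encoding (X : Type) [Fintype X] [Nonempty X] : Nonempty (Encoding X) := by
  let bot : X := Classical.arbitrary X
  choose f hf using exists_injOn_ne (P := ℝ≥0) bot
  choose g hg using exists_injOn_ne (P := ℝ≥0 × ℝ≥0) bot
  exact ⟨⟨bot, f, g, fun Y h => (hf Y h).1, fun Y h => (hf Y h).2, fun S h => (hg S h).1⟩⟩

/-- The first coordinates of the points of a frame. -/
def xs (r : Frame) : Finset ℝ≥0 := r.support.image Prod.fst

/-- The second coordinates of the points of a frame. -/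
def ys (r : Frame) : Finset ℝ≥0 := r.support.image Prod.snd

namespace Encoding

variable {X : Type} [Fintype X] [DecidableEq X] (C : Encoding X)

/-- The coordinate that a basis vector represents, and `0` if it represents none. -/
def value (Y : Finset ℝ≥0) (a : X) : ℝ := ∑ y ∈ Y, if a = C.coord Y y then (y : ℝ) else 0

theorem value_nonneg (Y : Finset ℝ≥0) (a : X) : 0 ≤ C.value Y a :=
  Finset.sum_nonneg fun y _ => by split_ifs <;> simp

variable {C}

theorem value_coord {Y : Finset ℝ≥0} (hY : Y.card < Fintype.card X) {y : ℝ≥0} (hy : y ∈ Y) :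
    C.value Y (C.coord Y y) = y := by
  rw [value, Finset.sum_eq_single_of_mem y hy, if_pos rfl]
  exact fun y' hy' hne => if_neg fun h => hne (C.coord_injOn Y hY hy hy' h).symm

theorem value_bot {Y : Finset ℝ≥0} (hY : Y.card < Fintype.card X) : C.value Y C.bot = 0 :=
  Finset.sum_eq_zero fun y hy => if_neg fun h => C.coord_ne_bot Y hY y hy h.symm

variable (C)

/-- The code of a point of a frame in Alice's register and the message. -/
def codeAM (r : Frame) (s : r.support) : X × X :=
  (C.coord (xs r) (s : ℝ≥0 × ℝ≥0).1, C.point r.support s)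

/-- The code of a point of a frame in the message and Bob's register. -/
def codeMB (r : Frame) (s : r.support) : X × X :=
  (C.point r.support s, C.coord (ys r) (s : ℝ≥0 × ℝ≥0).2)

/-- The honest state that represents a frame. -/
def state (r : Frame) (v : X × X × X) : ℂ :=
  ∑ s ∈ r.support, if v = (C.coord (xs r) s.1, C.point r.support s, C.coord (ys r) s.2)
    then (√(r s : ℝ) : ℂ) else 0

/-- The same state has two readings, by which player is active; this one serves Alice's moves and
its counterpart below Bob's. -/
theorem state_eq_amplitudeAM (r : Frame) (a m b : X) :
    C.state r (a, m, b) = amplitude (Equiv.refl _) r (C.codeAM r) (C.coord (ys r)) (a, m) b := by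
  rw [state, amplitude, ← Finset.sum_coe_sort]
  refine Finset.sum_congr rfl fun s _ => ?_
  simp only [codeAM, Prod.mk.injEq, Equiv.refl_apply]
  split_ifs <;> simp_all

theorem state_eq_amplitudeMB (r : Frame) (a : X) (y : X × X) :
    C.state r (a, y) = amplitude (Equiv.prodComm _ _) r (C.codeMB r) (C.coord (xs r)) y a := by
  obtain ⟨m, b⟩ := y
  rw [state, amplitude, ← Finset.sum_coe_sort]
  refine Finset.sum_congr rfl fun s _ => ?_
  simp only [codeMB, Prod.mk.injEq, Equiv.prodComm_apply, Prod.swap]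
  split_ifs <;> simp_all

variable {C} {p q r : Frame}

theorem card_xs_lt (hr : r.support.card < Fintype.card X) : (xs r).card < Fintype.card X :=
  Finset.card_image_le.trans_lt hr

theorem card_ys_lt (hr : r.support.card < Fintype.card X) : (ys r).card < Fintype.card X :=
  Finset.card_image_le.trans_lt hr

theorem mem_xs (s : r.support) : (s : ℝ≥0 × ℝ≥0).1 ∈ xs r := Finset.mem_image_of_mem _ s.2

theorem mem_ys (s : r.support) : (s : ℝ≥0 × ℝ≥0).2 ∈ ys r := Finset.mem_image_of_mem _ s.2

/-- The message alone identifies the point. -/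
theorem codeAM_injective (hr : r.support.card < Fintype.card X) :
    (C.codeAM r).Injective := fun s t h =>
  Subtype.ext (C.point_injOn _ hr s.2 t.2 (Prod.ext_iff.1 h).2)

theorem codeMB_injective (hr : r.support.card < Fintype.card X) :
    (C.codeMB r).Injective := fun s t h =>
  Subtype.ext (C.point_injOn _ hr s.2 t.2 (Prod.ext_iff.1 h).1)

/-- Alice's move for a horizontal transition. -/
theorem exists_unitaryAM (τ : Transition (Equiv.refl _) p q)
    (hp : p.support.card < Fintype.card X) (hq : q.support.card < Fintype.card X) :
    ∃ U ∈ Matrix.unitaryGroup (X × X) ℂ,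
      (diagonal (fun y : X × X => (C.value (xs q) y.1 : ℂ)) -
        (U * rangeProj (C.codeAM q))ᴴ * diagonal (fun y : X × X => (C.value (xs p) y.1 : ℂ)) *
          (U * rangeProj (C.codeAM q))).PosSemidef ∧
      onAM U *ᵥ C.state q = C.state p := by
  have hys : ys p = ys q := τ.image_eq
  -- The discarded part reuses the message codes of `q` and is kept apart from the codes of `p` by
  -- `bot` in Alice's register. So the dimension has to exceed each point count separately, not
  -- their sum.
  have hinj : (Sum.elim (C.codeAM p) fun s : q.support => (C.bot, C.point q.support s)).Injective := by
    rintro (s | s) (t | t) h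
    · rw [codeAM_injective hp h]
    · exact absurd (Prod.ext_iff.1 h).1 (C.coord_ne_bot _ (card_xs_lt hp) _ (mem_xs s))
    · exact absurd (Prod.ext_iff.1 h).1.symm (C.coord_ne_bot _ (card_xs_lt hp) _ (mem_xs t))
    · rw [Subtype.ext (C.point_injOn _ hq s.2 t.2 (Prod.ext_iff.1 h).2)]
  obtain ⟨U, hU, hdual, hev⟩ := τ.exists_unitary (Y := X × X) (B := X) (codeAM_injective (C := C) hq)
    (Z := fun y => C.value (xs q) y.1) (Z' := fun y => C.value (xs p) y.1)
    (g := C.coord (ys q)) hinj (fun y => C.value_nonneg _ _)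
    (fun s => value_coord (card_xs_lt hq) (mem_xs s))
    (fun t => value_coord (card_xs_lt hp) (mem_xs t))
    (fun s => value_bot (card_xs_lt hp)) (C.coord_injOn _ (card_ys_lt hq))
  refine ⟨U, hU, hdual, ?_⟩
  funext ⟨a, m, b⟩
  rw [onAM_mulVec]
  simp_rw [state_eq_amplitudeAM, hys]
  exact hev (a, m) b

/-- Bob's move for a vertical transition. -/
theorem exists_unitaryMB (τ : Transition (Equiv.prodComm _ _) p q)
    (hp : p.support.card < Fintype.card X) (hq : q.support.card < Fintype.card X) :
    ∃ U ∈ Matrix.unitaryGroup (X × X) ℂ,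
      (diagonal (fun y : X × X => (C.value (ys q) y.2 : ℂ)) -
        (U * rangeProj (C.codeMB q))ᴴ * diagonal (fun y : X × X => (C.value (ys p) y.2 : ℂ)) *
          (U * rangeProj (C.codeMB q))).PosSemidef ∧
      onMB U *ᵥ C.state q = C.state p := by
  have hxs : xs p = xs q := τ.image_eq
  have hinj : (Sum.elim (C.codeMB p) fun s : q.support => (C.point q.support s, C.bot)).Injective := by
    rintro (s | s) (t | t) h
    · rw [codeMB_injective hp h]
    · exact absurd (Prod.ext_iff.1 h).2 (C.coord_ne_bot _ (card_ys_lt hp) _ (mem_ys s))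
    · exact absurd (Prod.ext_iff.1 h).2.symm (C.coord_ne_bot _ (card_ys_lt hp) _ (mem_ys t))
    · rw [Subtype.ext (C.point_injOn _ hq s.2 t.2 (Prod.ext_iff.1 h).1)]
  obtain ⟨U, hU, hdual, hev⟩ := τ.exists_unitary (Y := X × X) (B := X) (codeMB_injective (C := C) hq)
    (Z := fun y => C.value (ys q) y.2) (Z' := fun y => C.value (ys p) y.2)
    (g := C.coord (xs q)) hinj (fun y => C.value_nonneg _ _)
    (fun s => value_coord (card_ys_lt hq) (mem_ys s))
    (fun t => value_coord (card_ys_lt hp) (mem_ys t))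
    (fun s => value_bot (card_ys_lt hp)) (C.coord_injOn _ (card_xs_lt hq))
  refine ⟨U, hU, hdual, ?_⟩
  funext ⟨a, m, b⟩
  rw [onMB_mulVec]
  simp_rw [state_eq_amplitudeMB, hxs]
  exact hev (m, b) a

theorem onAM_rangeProj_state : onAM (rangeProj (C.codeAM r)) *ᵥ C.state r = C.state r := by
  funext ⟨a, m, b⟩
  rw [onAM_mulVec, state_eq_amplitudeAM, ← rangeProj_amplitude]
  simp_rw [state_eq_amplitudeAM]
  exact mulVec_diagonal _ (fun y => amplitude _ r (C.codeAM r) _ y b) (a, m)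

theorem onMB_rangeProj_state : onMB (rangeProj (C.codeMB r)) *ᵥ C.state r = C.state r := by
  funext ⟨a, m, b⟩
  rw [onMB_mulVec, state_eq_amplitudeMB, ← rangeProj_amplitude]
  simp_rw [state_eq_amplitudeMB]
  exact mulVec_diagonal _ (fun y => amplitude _ r (C.codeMB r) _ y a) (m, b)

end Encoding

/-! ### Final measurements and the first frame -/

/-- The measurement with outcome `zero` on the basis vector `x₀`, `one` on the basis vector `x₁`,
and `bot` on all others. -/
def basisMeasurement {X : Type} [Fintype X] [DecidableEq X] {x₀ x₁ : X} (h : x₀ ≠ x₁) :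
    FinalMeasurement X where
  proj
    | .zero => diagonal (({x₀} : Set X).indicator 1)
    | .one => diagonal (({x₁} : Set X).indicator 1)
    | .bot => diagonal (({x₀, x₁}ᶜ : Set X).indicator 1)
  isProj o := by
    cases o <;> exact isStarProjection_diagonal_indicator _
  complete := by
    rw [diagonal_add, diagonal_add, ← diagonal_one]
    congr 1
    funext x
    by_cases h0 : x = x₀
    · subst h0
      simp [h]
    · by_cases h1 : x = x₁
      · subst h1
        simp [h0]
      · simp [h0, h1]

/-- The first frame of a point game. -/
def startFrame (Λ : ℝ≥0) : Frame :=
  weightedPoint (1 / 2) Λ (Λ + 1) + weightedPoint (1 / 2) (Λ + 1) Λ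

theorem ne_add_one (Λ : ℝ≥0) : Λ ≠ Λ + 1 := (lt_add_one Λ).ne

theorem startFrame_apply_left (Λ : ℝ≥0) : startFrame Λ (Λ, Λ + 1) = 1 / 2 := by
  simp [startFrame, weightedPoint]

theorem startFrame_apply_right (Λ : ℝ≥0) : startFrame Λ (Λ + 1, Λ) = 1 / 2 := by
  simp [startFrame, weightedPoint]

theorem startFrame_support (Λ : ℝ≥0) : (startFrame Λ).support = {(Λ, Λ + 1), (Λ + 1, Λ)} := by
  ext s
  rw [Finsupp.mem_support_iff, Finset.mem_insert, Finset.mem_singleton]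
  constructor
  · contrapose!
    rintro ⟨h1, h2⟩
    simp [startFrame, weightedPoint, h1.symm, h2.symm]
  · rintro (rfl | rfl)
    · simp [startFrame_apply_left]
    · simp [startFrame_apply_right]

theorem xs_startFrame (Λ : ℝ≥0) : xs (startFrame Λ) = {Λ, Λ + 1} := by
  rw [xs, startFrame_support, Finset.image_insert, Finset.image_singleton]

theorem ys_startFrame (Λ : ℝ≥0) : ys (startFrame Λ) = {Λ + 1, Λ} := by
  rw [ys, startFrame_support, Finset.image_insert, Finset.image_singleton]

theorem weightedPoint_support (x y : ℝ≥0) : (weightedPoint 1 x y).support = {(x, y)} :=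
  Finsupp.support_single _ one_ne_zero

theorem startFrame_ne_weightedPoint (Λ x y : ℝ≥0) : startFrame Λ ≠ weightedPoint 1 x y := by
  intro h
  have hc := congrArg (fun r : Frame => r.support.card) h
  simp only [startFrame_support, weightedPoint_support, Finset.card_singleton] at hc
  rw [Finset.card_pair fun h => ne_add_one Λ (Prod.ext_iff.1 h).1] at hc
  omega

variable {X : Type} [Fintype X] [DecidableEq X] {C : Encoding X}

/-- The dual matrix at the end of the protocol is the matrix of rewards. -/
theorem smul_basisMeasurement_eq_value {Y : Finset ℝ≥0} {Λ : ℝ≥0}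
    (hYΛ : Y = {Λ, Λ + 1}) :
    ((Λ : ℂ) + 1) • (diagonal (({C.coord Y (Λ + 1)} : Set X).indicator 1) : Matrix X X ℂ) +
      (Λ : ℂ) • diagonal (({C.coord Y Λ} : Set X).indicator 1) =
      diagonal fun a => (C.value Y a : ℂ) := by
  rw [← diagonal_smul, ← diagonal_smul, diagonal_add]
  congr 1
  funext a
  have hv : C.value Y a = (if a = C.coord Y Λ then (Λ : ℝ) else 0) +
      if a = C.coord Y (Λ + 1) then (Λ : ℝ) + 1 else 0 := by
    rw [Encoding.value]
    conv_lhs => enter [1]; rw [hYΛ]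
    rw [Finset.sum_pair (ne_add_one Λ)]
    simp
  rw [hv]
  simp only [Pi.smul_apply, Set.indicator_apply, Set.mem_singleton_iff, Pi.one_apply, smul_eq_mul]
  split_ifs <;> (simp; try ring)

theorem state_startFrame (C : Encoding X) (Λ : ℝ≥0) (v : X × X × X) :
    C.state (startFrame Λ) v =
      (if v = (C.coord (xs (startFrame Λ)) Λ, C.point (startFrame Λ).support (Λ, Λ + 1),
        C.coord (ys (startFrame Λ)) (Λ + 1)) then (√(1 / 2) : ℂ) else 0) +
      if v = (C.coord (xs (startFrame Λ)) (Λ + 1), C.point (startFrame Λ).support (Λ + 1, Λ),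
        C.coord (ys (startFrame Λ)) Λ) then (√(1 / 2) : ℂ) else 0 := by
  rw [Encoding.state]
  conv_lhs => enter [1]; rw [startFrame_support]
  rw [Finset.sum_pair fun h => ne_add_one Λ (Prod.ext_iff.1 h).1, startFrame_apply_left,
    startFrame_apply_right]
  simp

theorem normSq_ite {Y : Type} [Fintype Y] [DecidableEq Y] (v₀ : Y) (z : ℂ) :
    normSq (fun v => if v = v₀ then z else 0) = ‖z‖ ^ 2 := by
  simp [normSq, apply_ite (fun z : ℂ => ‖z‖ ^ 2)]

theorem norm_sqrt_half_sq : ‖(√(1 / 2) : ℂ)‖ ^ 2 = 1 / 2 := by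
  rw [Complex.norm_real, Real.norm_eq_abs, sq_abs, Real.sq_sqrt (by norm_num)]

/-- The final measurements on a correlated pair of basis states. -/
theorem onAB_basisMeasurement_mulVec {A M B : Type} [Fintype A] [DecidableEq A] [Fintype M]
    [DecidableEq M] [Fintype B] [DecidableEq B] {a₀ a₁ : A} (ha : a₀ ≠ a₁) {b₀ b₁ : B}
    (hb : b₀ ≠ b₁) (m₀ m₁ : M) (z : ℂ) {ψ : A × M × B → ℂ}
    (hψ : ∀ v, ψ v = (if v = (a₀, m₀, b₀) then z else 0) + if v = (a₁, m₁, b₁) then z else 0)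
    (o o' : Outcome) :
    onAB ((basisMeasurement ha).proj o) ((basisMeasurement hb).proj o') *ᵥ ψ = fun v =>
      match o, o' with
      | .zero, .zero => if v = (a₀, m₀, b₀) then z else 0
      | .one, .one => if v = (a₁, m₁, b₁) then z else 0
      | _, _ => 0 := by
  funext v
  by_cases h0 : v = (a₀, m₀, b₀)
  · subst h0
    cases o <;> cases o' <;>
      simp [basisMeasurement, onAB_diagonal_mulVec, hψ, ha, hb]
  · by_cases h1 : v = (a₁, m₁, b₁)
    · subst h1
      cases o <;> cases o' <;>
        simp [basisMeasurement, onAB_diagonal_mulVec, hψ, ha.symm, hb.symm]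
    · cases o <;> cases o' <;>
        simp [basisMeasurement, onAB_diagonal_mulVec, hψ, h0, h1]

/-! ### Assembling the protocol -/

/-- A sequence of frames with horizontal transitions in the rounds of Alice and vertical ones in
the rounds of Bob gives a protocol. -/
theorem exists_protocol (Λ β α : ℝ≥0) {N : ℕ} (hN : Even N) (st : ℕ → Frame)
    (hcard : ∀ i, (st i).support.card < Fintype.card X)
    (hA : ∀ i, Even i → Nonempty (Transition (Equiv.refl _) (st (i + 1)) (st i)))
    (hB : ∀ i, ¬ Even i → Nonempty (Transition (Equiv.prodComm _ _) (st (i + 1)) (st i)))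
    (hinit : st 0 = weightedPoint 1 β α) (hend : st N = startFrame Λ) :
    ∃ P : Protocol X X X, P.IsPenWCF ∧ P.rounds = N ∧
      P.cheatRewardA Λ ≤ ((α : ℝ) : EReal) ∧ P.cheatRewardB Λ ≤ ((β : ℝ) : EReal) := by
  have : Nonempty X := Fintype.card_pos_iff.1 (Nat.zero_lt_of_lt (hcard 0))
  obtain ⟨C⟩ := exists_encoding X
  -- The parity condition is inside the existential, with the identity as default, so that a unitary
  -- can be chosen for every `i`.
  have exA : ∀ i, ∃ U ∈ Matrix.unitaryGroup (X × X) ℂ, Even i →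
      (diagonal (fun y : X × X => (C.value (xs (st i)) y.1 : ℂ)) -
        (U * rangeProj (C.codeAM (st i)))ᴴ *
          diagonal (fun y : X × X => (C.value (xs (st (i + 1))) y.1 : ℂ)) *
          (U * rangeProj (C.codeAM (st i)))).PosSemidef ∧
      onAM U *ᵥ C.state (st i) = C.state (st (i + 1)) := by
    intro i
    by_cases hi : Even i
    · obtain ⟨τ⟩ := hA i hi
      obtain ⟨U, hU, h⟩ := Encoding.exists_unitaryAM τ (hcard _) (hcard _)
      exact ⟨U, hU, fun _ => h⟩
    · exact ⟨1, one_mem _, fun h => absurd h hi⟩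
  have exB : ∀ i, ∃ U ∈ Matrix.unitaryGroup (X × X) ℂ, ¬ Even i →
      (diagonal (fun y : X × X => (C.value (ys (st i)) y.2 : ℂ)) -
        (U * rangeProj (C.codeMB (st i)))ᴴ *
          diagonal (fun y : X × X => (C.value (ys (st (i + 1))) y.2 : ℂ)) *
          (U * rangeProj (C.codeMB (st i)))).PosSemidef ∧
      onMB U *ᵥ C.state (st i) = C.state (st (i + 1)) := by
    intro i
    by_cases hi : Even i
    · exact ⟨1, one_mem _, fun h => absurd hi h⟩
    · obtain ⟨τ⟩ := hB i hi
      obtain ⟨U, hU, h⟩ := Encoding.exists_unitaryMB τ (hcard _) (hcard _)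
      exact ⟨U, hU, fun _ => h⟩
  choose UA hUA hUA' using exA
  choose UB hUB hUB' using exB
  have hx : (xs (startFrame Λ)).card < Fintype.card X := Encoding.card_xs_lt (hend ▸ hcard N)
  have hy : (ys (startFrame Λ)).card < Fintype.card X := Encoding.card_ys_lt (hend ▸ hcard N)
  -- The order of the two codes fixes the outcomes: the point `(Λ, Λ + 1)` means `zero` for both
  -- players, `(Λ + 1, Λ)` means `one`. The loser's coordinate is thus `Λ`-valued on the winner's
  -- register and `Λ + 1` on the other.
  have hxne : C.coord (xs (startFrame Λ)) Λ ≠ C.coord (xs (startFrame Λ)) (Λ + 1) := fun h =>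
    ne_add_one Λ (C.coord_injOn _ hx (by simp [xs_startFrame]) (by simp [xs_startFrame]) h)
  have hyne : C.coord (ys (startFrame Λ)) (Λ + 1) ≠ C.coord (ys (startFrame Λ)) Λ := fun h =>
    ne_add_one Λ (C.coord_injOn _ hy (by simp [ys_startFrame]) (by simp [ys_startFrame]) h).symm
  have hbasis : ∀ x₀ : X, normSq (fun x => if x = x₀ then (1 : ℂ) else 0) = 1 := fun x₀ => by
    rw [normSq_ite]
    simp
  let P : Protocol X X X :=
    { rounds := N
      even_rounds := hN
      initA := fun x => if x = C.coord (xs (st 0)) β then 1 else 0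
      initM := fun x => if x = C.point (st 0).support (β, α) then 1 else 0
      initB := fun x => if x = C.coord (ys (st 0)) α then 1 else 0
      initA_norm := hbasis _
      initM_norm := hbasis _
      initB_norm := hbasis _
      UA := UA
      EA := fun i => rangeProj (C.codeAM (st i))
      UB := UB
      EB := fun i => rangeProj (C.codeMB (st i))
      UA_unitary := hUA
      UB_unitary := hUB
      EA_proj := fun i => isStarProjection_rangeProj _
      EB_proj := fun i => isStarProjection_rangeProj _
      measA := basisMeasurement hxne
      measB := basisMeasurement hyne }
  have hsupp0 : (st 0).support = {(β, α)} := by rw [hinit, weightedPoint_support]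
  have hstate : ∀ i, P.honestState i = C.state (st i) := by
    intro i
    induction i with
    | zero =>
      funext ⟨a, m, b⟩
      rw [Encoding.state]
      conv_rhs => enter [1]; rw [hsupp0]
      rw [Finset.sum_singleton, hinit]
      simp only [Protocol.honestState, P, hinit, weightedPoint, Finsupp.single_eq_same,
        Prod.mk.injEq]
      split_ifs <;> simp_all
    | succ i ih =>
      rw [Protocol.honestState, ih]
      split_ifs with h
      · exact (hUA' i h).2
      · exact (hUB' i h).2
  have hfinal := onAB_basisMeasurement_mulVec hxne hyne _ _ _ (state_startFrame C Λ)
  have hlast : P.honestState P.rounds = C.state (startFrame Λ) := by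
    rw [hstate, ← hend]
  refine ⟨P, ⟨fun i _ => ?_, fun o o' h0 h1 => ?_, ?_, ?_⟩, rfl, iSup_le fun S => ?_,
    iSup_le fun S => ?_⟩
  · rw [hstate]
    split_ifs
    · exact Encoding.onAM_rangeProj_state
    · exact Encoding.onMB_rangeProj_state
  · rw [hlast]
    refine (hfinal o o').trans ?_
    cases o <;> cases o' <;> simp at h0 h1 <;> rfl
  · rw [hlast]
    exact (congrArg normSq (hfinal .zero .zero)).trans ((normSq_ite _ _).trans norm_sqrt_half_sq)
  · rw [hlast]
    exact (congrArg normSq (hfinal .one .one)).trans ((normSq_ite _ _).trans norm_sqrt_half_sq)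
  · rw [EReal.coe_le_coe_iff]
    refine (P.rewardOfAlice_le Λ (fun i => C.value (ys (st i))) (fun i _ h => (hUB' i h).1)
      -- In Alice's rounds the occupied `y` are the same before and after, and the code depends on
      -- nothing but this set, so Bob's certificate stays fixed.
      (fun i _ h => ?_) ?_ S).trans (le_of_eq ?_)
    · obtain ⟨τ⟩ := hA i h
      exact congrArg C.value τ.image_eq
    · simp only [P, hend]
      exact smul_basisMeasurement_eq_value (by rw [ys_startFrame, Finset.pair_comm])
    · rw [Finset.sum_eq_single (C.coord (ys (st 0)) α)]
      · rw [Encoding.value_coord (Encoding.card_ys_lt (hcard 0)) (by simp [ys, hsupp0])]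
        simp [P]
      · intro b _ hb
        simp [P, hb]
      · simp
  · rw [EReal.coe_le_coe_iff]
    refine (P.rewardOfBob_le Λ (fun i => C.value (xs (st i))) (fun i _ h => (hUA' i h).1)
      (fun i _ h => ?_) ?_ S).trans (le_of_eq ?_)
    · obtain ⟨τ⟩ := hB i h
      exact congrArg C.value τ.image_eq
    · simp only [P, hend]
      exact smul_basisMeasurement_eq_value (xs_startFrame Λ)
    · rw [Finset.sum_eq_single (C.coord (xs (st 0)) β)]
      · rw [Encoding.value_coord (Encoding.card_xs_lt (hcard 0)) (by simp [xs, hsupp0])]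
        simp [P]
      · intro a _ ha
        simp [P, ha]
      · simp

/-! ### Distributing the reversed game over the rounds -/

namespace EBMPointGame

/-- The first frame has two points and the last one has one, so they differ. -/
theorem pos {Λ : ℝ≥0} {n : ℕ} {β α : ℝ≥0} (G : EBMPointGame Λ n β α) : 0 < n := by
  rcases Nat.eq_zero_or_pos n with rfl | h
  · exact absurd (G.start.symm.trans G.final) (startFrame_ne_weightedPoint Λ β α)
  · exact h

variable {Λ : ℝ≥0} {n : ℕ} {β α : ℝ≥0} (G : EBMPointGame Λ n β α)

theorem card_support_lt (i : Fin (n + 1)) : (G.frame i).support.card < G.registerDim := by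
  refine Nat.lt_succ_of_le ?_
  have hle : ∀ j : Fin n, pointCount (G.frame j.castSucc) + pointCount (G.frame j.succ) ≤ _ :=
    fun j => Finset.le_sup (f := fun j : Fin n =>
      pointCount (G.frame j.castSucc) + pointCount (G.frame j.succ)) (Finset.mem_univ j)
  induction i using Fin.lastCases with
  | cast j => exact (Nat.le_add_right _ _).trans (hle j)
  -- The last frame occurs in the maximum only as the target of a step, so at least one step is
  -- needed.
  | last =>
    obtain ⟨m, rfl⟩ := Nat.exists_eq_succ_of_ne_zero G.pos.ne'
    exact (Nat.le_add_left _ _).trans (hle (Fin.last m))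

/-- The frames in the temporal order of the protocol. -/
def reversed (k : ℕ) : Frame := G.frame ⟨n - k, by omega⟩

/-- The frame that the honest state represents before round `i`. -/
def roundFrame (i : ℕ) : Frame :=
  -- Rounds `2k` and `2k + 1` realise step `n - 1 - k` of the game. If its index is odd, the step is
  -- horizontal and Alice has completed it before round `2k + 1`; otherwise it is left to Bob.
  if ¬ Even i ∧ Odd (n - 1 - i / 2) then G.reversed (i / 2 + 1) else G.reversed (i / 2)

theorem card_roundFrame_lt (i : ℕ) : (G.roundFrame i).support.card < G.registerDim := by
  rw [roundFrame]
  split_ifs <;> exact G.card_support_lt _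

/-- Truncated subtraction keeps the sequence at the first frame of the game, so transitions exist
for all indices. -/
theorem reversed_succ_of_le {k : ℕ} (hk : n ≤ k) : G.reversed (k + 1) = G.reversed k := by
  simp only [reversed, Nat.sub_eq_zero_of_le hk, Nat.sub_eq_zero_of_le (Nat.le_succ_of_le hk)]

theorem reversed_eq {k : ℕ} {i : Fin (n + 1)} (h : n - k = i) : G.reversed k = G.frame i :=
  congrArg G.frame (Fin.ext h)

theorem reversed_horizontal {k : ℕ} (h : Odd (n - 1 - k)) :
    EBMHorizontal (G.reversed (k + 1)) (G.reversed k) := by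
  have hpos := h.pos
  have hlt : n - 1 - k < n := by omega
  rw [G.reversed_eq (i := (⟨n - 1 - k, hlt⟩ : Fin n).castSucc)
      (by change n - (k + 1) = n - 1 - k; omega),
    G.reversed_eq (i := (⟨n - 1 - k, hlt⟩ : Fin n).succ) (by change n - k = n - 1 - k + 1; omega)]
  exact G.horizontal _ h

/-- Here `k < n` must be assumed, because the truncated value `0` of `n - 1 - k` is even; in the
horizontal case oddness implies it. -/
theorem reversed_vertical {k : ℕ} (hk : k < n) (h : Even (n - 1 - k)) :
    EBMVertical (G.reversed (k + 1)) (G.reversed k) := by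
  have hlt : n - 1 - k < n := by omega
  rw [G.reversed_eq (i := (⟨n - 1 - k, hlt⟩ : Fin n).castSucc)
      (by change n - (k + 1) = n - 1 - k; omega),
    G.reversed_eq (i := (⟨n - 1 - k, hlt⟩ : Fin n).succ) (by change n - k = n - 1 - k + 1; omega)]
  exact G.vertical _ h

theorem transition_horizontal {i : ℕ} (hi : Even i) :
    Nonempty (Transition (Equiv.refl _) (G.roundFrame (i + 1)) (G.roundFrame i)) := by
  obtain ⟨k, rfl⟩ := hi.exists_two_nsmul
  have h1 : (2 • k + 1) / 2 = k := by simp; omega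
  have h2 : (2 • k) / 2 = k := by simp
  have h3 : ¬ Even (2 • k + 1) := by simp
  rw [roundFrame, roundFrame, h1, h2]
  simp only [h3, hi, not_true_eq_false, not_false_eq_true, true_and, false_and, if_false]
  split_ifs with h
  · exact (G.reversed_horizontal h).exists_transition
  · exact ⟨Transition.refl _ _⟩

theorem transition_vertical {i : ℕ} (hi : ¬ Even i) :
    Nonempty (Transition (Equiv.prodComm _ _) (G.roundFrame (i + 1)) (G.roundFrame i)) := by
  obtain ⟨k, rfl⟩ := Nat.not_even_iff_odd.1 hi
  have h1 : (2 * k + 1) / 2 = k := by omega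
  have h2 : (2 * k + 1 + 1) / 2 = k + 1 := by omega
  have h3 : Even (2 * k + 1 + 1) := by simp [Nat.even_add_one]
  rw [roundFrame, roundFrame, h1, h2]
  simp only [h3, hi, not_true_eq_false, not_false_eq_true, true_and, false_and, if_false]
  split_ifs with h
  · exact ⟨Transition.refl _ _⟩
  · rcases lt_or_ge k n with hk | hk
    · exact (G.reversed_vertical hk (Nat.not_odd_iff_even.1 h)).exists_transition
    · rw [G.reversed_succ_of_le hk]
      exact ⟨Transition.refl _ _⟩

theorem roundFrame_zero : G.roundFrame 0 = weightedPoint 1 β α := by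
  simp only [roundFrame, reversed, Even.zero, not_true_eq_false, false_and, if_false]
  exact G.final

theorem roundFrame_last : G.roundFrame (2 * n) = startFrame Λ := by
  have h : (2 * n) / 2 = n := by omega
  simp only [roundFrame, reversed, even_two_mul, not_true_eq_false, false_and, if_false, h,
    Nat.sub_self]
  exact G.start

/-- Any basis type with at least $D$ elements will do, which covers both registers of dimension $D$
and registers of qubits. -/
theorem exists_protocol (hX : G.registerDim ≤ Fintype.card X) :
    ∃ P : Protocol X X X, P.IsPenWCF ∧ P.rounds = 2 * n ∧
      P.cheatRewardA Λ ≤ ((α : ℝ) : EReal) ∧ P.cheatRewardB Λ ≤ ((β : ℝ) : EReal) :=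
  PenWCF.exists_protocol Λ β α (even_two_mul n) G.roundFrame
    (fun i => (G.card_roundFrame_lt i).trans_le hX) (fun _ => G.transition_horizontal)
    (fun _ => G.transition_vertical) G.roundFrame_zero G.roundFrame_last

end EBMPointGame

end PenWCF

end

theorem mainTheorem5 (Λ : ℝ≥0) (n : ℕ) (β α : ℝ≥0) (G : PenWCF.EBMPointGame Λ n β α) :
    (∃ P : PenWCF.Protocol (Fin G.registerDim) (Fin G.registerDim) (Fin G.registerDim),
      P.IsPenWCF ∧ P.rounds = 2 * n ∧
        P.cheatRewardA Λ ≤ ((α : ℝ) : EReal) ∧ P.cheatRewardB Λ ≤ ((β : ℝ) : EReal)) ∧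
    (∃ P : PenWCF.Protocol (PenWCF.Qubits (Nat.clog 2 G.registerDim))
        (PenWCF.Qubits (Nat.clog 2 G.registerDim)) (PenWCF.Qubits (Nat.clog 2 G.registerDim)),
      P.IsPenWCF ∧ P.rounds = 2 * n ∧
        P.cheatRewardA Λ ≤ ((α : ℝ) : EReal) ∧ P.cheatRewardB Λ ≤ ((β : ℝ) : EReal)) := by
  refine ⟨G.exists_protocol (by simp), G.exists_protocol ?_⟩
  simpa using Nat.le_pow_clog one_lt_two G.registerDim
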